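/- Let $d\ge 1$, let $f_U:\mathbb R^d\to[0,\infty)$ be measurable with $0<\int f_U<\infty$ (all integrals are with respect to Lebesgue measure), and let $f=f_U/\int f_U$. Let $K:\mathbb R^d\to[0,\infty)$ and put $K_h(u)=h^{-d}K(u/h)$ for $h>0$. Assume: (H1) $f$ is a probability density, twice continuously differentiable, with bounded second derivatives. (H2) $q_0$ is a probability density on $\mathbb R^d$; for every $\eta\in(0,1]$ there is $c_\eta>0$ with $f(x)^\eta\le c_\eta q_0(x)$ for all $x$; and there are $C_0,r_0>0$ with $q_0(x)\le C_0(1+\|x\|)^{-r_0}$ for all $x$. (H3) $K$ is a Lipschitz probability density with $\int uK(u)\,du=0$, $\int\|u\|^2K(u)\,du<\infty$, and there are $C_K,r_K>0$ with $K(x)\le C_K(1+\|x\|)^{-r_K}$ for all $x$. Let $(h_k)_{k\ge1}$ be a bounded sequence of positive numbers, let $(\lambda_k)_{k\ge1}\subset(0,1]$ be nonincreasing, and let $a_n=\sqrt{\log(n)/(n h_n^d)}$. Let $(X_k)_{k\ge1}$ be generated by standard safe adaptive importance sampling (SAIS): for every $k\ge0$, conditionally on $\mathcal F_k=\sigma(X_1,\dots,X_k)$,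 the variable $X_{k+1}$ has density $q_k$ ($\mathcal F_0$ is trivial), where $q_0$ is the density of (H2) and, for $k\ge1$, $$q_k=(1-\lambda_k)f_k+\lambda_kq_0,\qquad f_n(x)=\sum_{k=1}^nW_{n,k}K_{h_n}(x-X_k).$$ Here $W_k=f_U(X_k)/q_{k-1}(X_k)$, and $(W_{n,k})_{1\le k\le n}$ is the probability vector proportional to $(W_k)_{1\le k\le n}$. If $W_1=\dots=W_n=0$, then $(W_{n,k})_{1\le k\le n}$ may be any probability vector, as long as $q_n$ remains $\mathcal F_n$-measurable as a random function. If there is $\epsilon>0$ such that, as $n\to\infty$, $(a_n+h_n^4)/\lambda_n^{1+\epsilon}\to0$ and $\lambda_n^{1+\epsilon}\to0$, then with probability $1$ $$\sup_{x\in\mathbb R^d}|f_n(x)-f(x)|=O(a_n+h_n^2),$$ that is, almost surely there is a finite (random) constant $C$ such that $\sup_{x\in\mathbb R^d}|f_n(x)-f(x)|\le C(a_n+h_n^2)$ for all $n\ge1$. -/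

import Mathlib

open MeasureTheory Filter Topology Asymptotics

namespace SAIS

/-- The Euclidean space `ℝ^d`. -/
abbrev Space (d : ℕ) : Type := EuclideanSpace ℝ (Fin d)

/-- Probability density function with respect to Lebesgue measure on `ℝ^d`. -/
structure IsDensity {d : ℕ} (g : Space d → ℝ) : Prop where
  measurable : Measurable g
  nonneg : ∀ x, 0 ≤ g x
  integrable : Integrable g
  integral_eq_one : ∫ x, g x = 1

/-- The sigma-field `F_k = σ(X_1, …, X_k)`; it is trivial for `k = 0`. The value `X 0` is not
used. -/
@[reducible] def naturalSigma {Ω : Type*} {d : ℕ} (X : ℕ → Ω → Space d) (k : ℕ) : MeasurableSpace Ω :=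
  ⨆ i ∈ Set.Icc 1 k, MeasurableSpace.comap (X i) inferInstance

/-- `(q_k)_{k ≥ 0}` is the policy of `(X_k)_{k ≥ 1}`: a sequence of random probability densities
adapted to `(F_k)_{k ≥ 0}` such that, conditionally on `F_k`, the law of `X_{k+1}` has density
`q_k`. -/
structure IsPolicy {Ω : Type*} [MeasurableSpace Ω] {d : ℕ} (P : Measure Ω)
    (X : ℕ → Ω → Space d) (q : ℕ → Ω → Space d → ℝ) : Prop where
  measurable_particle : ∀ k, Measurable (X (k + 1))
  density : ∀ k ω, IsDensity (q k ω)
  adapted : ∀ k, Measurable[MeasurableSpace.prod (naturalSigma X k) inferInstance]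
    (fun p : Ω × Space d => q k p.1 p.2)
  condLaw : ∀ k (A : Set (Space d)), MeasurableSet A →
    P[(X (k + 1) ⁻¹' A).indicator (fun _ => (1 : ℝ)) | naturalSigma X k]
      =ᵐ[P] fun ω => ∫ x in A, q k ω x

/-- The target density `f = f_U / ∫ f_U`. -/
noncomputable def target {d : ℕ} (fU : Space d → ℝ) (x : Space d) : ℝ :=
  fU x / ∫ y, fU y

/-- The importance weights `W_k = f_U(X_k) / q_{k-1}(X_k)`, `k ≥ 1`. -/
noncomputable def importanceWeight {Ω : Type*} {d : ℕ} (fU : Space d → ℝ)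
    (X : ℕ → Ω → Space d) (q : ℕ → Ω → Space d → ℝ) (ω : Ω) (k : ℕ) : ℝ :=
  fU (X k ω) / q (k - 1) ω (X k ω)

/-- `(v_k)_{k = 1, …, n}` is a probability vector proportional to `(W_k)_{k = 1, …, n}`. If the
`W_k` have a positive sum this says exactly that `v_k = W_k / ∑ j, W_j`; if all the `W_k` vanish,
`v` may be any probability vector. -/
structure IsNormalizedWeights (n : ℕ) (W v : ℕ → ℝ) : Prop where
  nonneg : ∀ k ∈ Finset.Icc 1 n, 0 ≤ v k
  sum_eq_one : ∑ k ∈ Finset.Icc 1 n, v k = 1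
  proportional : ∀ k ∈ Finset.Icc 1 n, (∑ j ∈ Finset.Icc 1 n, W j) * v k = W k

/-- The rescaled kernel `K_h(u) = K(u / h) / h^d`. -/
noncomputable def scaledKernel {d : ℕ} (K : Space d → ℝ) (h : ℝ) (u : Space d) : ℝ :=
  K (h⁻¹ • u) / h ^ d

/-- The weighted kernel estimate `f_n(x) = ∑_{k=1}^n W_{n,k} K_{h_n}(x - X_k)`. -/
noncomputable def kernelEstimate {Ω : Type*} {d : ℕ} (K : Space d → ℝ) (h : ℕ → ℝ)
    (X : ℕ → Ω → Space d) (w : ℕ → Ω → ℕ → ℝ) (n : ℕ) (ω : Ω) (x : Space d) : ℝ :=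
  ∑ k ∈ Finset.Icc 1 n, w n ω k * scaledKernel K (h n) (x - X k ω)

/-- The particles `X_k`, the policy `q_k` and the normalized weights `W_{n,k} = w n ω k` of standard
safe adaptive importance sampling: `X_{k+1}` is drawn from `q_k`, where the policy starts at the
safe density `q_0` and `q_k = (1 - λ_k) f_k + λ_k q_0` for `k ≥ 1`. -/
structure IsStandardSAIS {Ω : Type*} [MeasurableSpace Ω] {d : ℕ} (P : Measure Ω)
    (fU q0 K : Space d → ℝ) (h lam : ℕ → ℝ) (X : ℕ → Ω → Space d)
    (q : ℕ → Ω → Space d → ℝ) (w : ℕ → Ω → ℕ → ℝ) : Prop where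
  policy : IsPolicy P X q
  weights : ∀ ω n, 1 ≤ n → IsNormalizedWeights n (importanceWeight fU X q ω) (w n ω)
  init : ∀ ω x, q 0 ω x = q0 x
  update : ∀ k, 1 ≤ k → ∀ ω x,
    q k ω x = (1 - lam k) * kernelEstimate K h X w k ω x + lam k * q0 x

/-- The target is a twice continuously differentiable density with bounded second derivatives. -/
structure SmoothTarget {d : ℕ} (f : Space d → ℝ) : Prop where
  density : IsDensity f
  contDiff : ContDiff ℝ 2 f
  bounded_second : ∃ C : ℝ, ∀ x, ‖iteratedFDeriv ℝ 2 f x‖ ≤ C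

/-- The safe density dominates every power `f^η`, `η ∈ (0, 1]`, and has polynomial decay. -/
structure SafeDensity {d : ℕ} (f q0 : Space d → ℝ) : Prop where
  density : IsDensity q0
  dominates : ∀ η : ℝ, 0 < η → η ≤ 1 → ∃ c : ℝ, 0 < c ∧ ∀ x, f x ^ η ≤ c * q0 x
  tail : ∃ C r : ℝ, 0 < C ∧ 0 < r ∧ ∀ x, q0 x ≤ C * (1 + ‖x‖) ^ (-r)

/-- The kernel is a centred Lipschitz density with a finite second moment and polynomial decay. -/
structure AdmissibleKernel {d : ℕ} (K : Space d → ℝ) : Prop where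
  density : IsDensity K
  lipschitz : ∃ L : NNReal, LipschitzWith L K
  second_moment : Integrable (fun u : Space d => ‖u‖ ^ 2 * K u)
  centred : ∫ u : Space d, K u • u = 0
  tail : ∃ C r : ℝ, 0 < C ∧ 0 < r ∧ ∀ x, K x ≤ C * (1 + ‖x‖) ^ (-r)

/-- The rate `a_n = √(log n / (n h_n^d))`. -/
noncomputable def rate (d : ℕ) (h : ℕ → ℝ) (n : ℕ) : ℝ :=
  Real.sqrt (Real.log n / (n * h n ^ d))

end SAIS

-- Write U = ∫ `fU`, `H = h_n^(-d)`, and let φ be a test function. The estimate is a ratio of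
-- importance sampling sums `weightedSum`, whose terms are conditionally unbiased for ∫ `fU` φ. Its
-- error is a martingale deviation plus the `h_n^2` bias of smoothing. The size of the deviation
-- depends on the conditional variance ∫ `fU`²φ²/`q_k`, hence on how well `q_k` dominates `fU`².
--
-- That domination is measured by `fU² ≤ B * v * f^κ * q_k`, with `κ = ε / (1 + ε)`. The factor
-- `f^κ` is bounded, integrable and has small tails, so the test functions needed have variance of
-- order `v * H`. Freedman's inequality (`IsPolicy.measure_weightedSum_le`), a union over
-- polynomially many test functions and Borel–Cantelli (`IsPolicy.eventually_deviation_le`) then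
-- give deviations of order `a_n * √v`; jumps are harmless because `fU / q_k` is at most of order `1
-- / λ_n` and `a_n / λ_n → 0`. A grid handles moderate `x` and a tail indicator handles large `x`
-- (`kernel_deviation_le`). This is the conditional rate
-- `IsStandardSAIS.eventually_abs_kernelEstimate_sub_le`.
--
-- It is applied twice. The safe component alone gives `v = 1 / λ_n`
-- (`IsStandardSAIS.exists_sq_le_div`), so the error is `O(λ_n^((1+ε)/2))`. This accuracy feeds back
-- into the policy: where `f` exceeds twice the error, `q_k ≥ f / 4`; elsewhere `f^(2-2κ)` is
-- `O(λ_k)`, which the safe component absorbs. So the domination holds with `v = 1` and a random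
-- constant (`IsStandardSAIS.exists_sq_le`), and the second application gives `a_n + h_n^2`.

namespace SAIS

/-! ### Conditional sampling and normalised exponential products -/

/-- If `ν`-a.e. `g (π ω, ·)` is the density of the conditional law of `Y` given `π`, tested on
rectangles, then it computes all expectations of functions of `(π, Y)`. -/
theorem lintegral_comp_prodMk_of_rectangles {Ω Ω' E : Type*} [MeasurableSpace Ω]
    {mΩ' : MeasurableSpace Ω'} [MeasurableSpace E] (P : Measure Ω) [IsProbabilityMeasure P]
    (ν : Measure E) [SFinite ν] {p : Ω → Ω'} (hp : Measurable p) {Y : Ω → E} (hY : Measurable Y)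
    {g : Ω' × E → ENNReal} (hg : Measurable g)
    (hrect : ∀ (B : Set Ω') (A : Set E), MeasurableSet B → MeasurableSet A →
      P (p ⁻¹' B ∩ Y ⁻¹' A) = ∫⁻ ω in p ⁻¹' B, ∫⁻ x in A, g (p ω, x) ∂ν ∂P)
    {Φ : Ω' × E → ENNReal} (hΦ : Measurable Φ) :
    ∫⁻ ω, Φ (p ω, Y ω) ∂P = ∫⁻ ω, ∫⁻ x, Φ (p ω, x) * g (p ω, x) ∂ν ∂P := by
  have hpY : Measurable fun ω => (p ω, Y ω) := hp.prodMk hY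
  have key : P.map (fun ω => (p ω, Y ω)) = ((P.map p).prod ν).withDensity g := by
    have : IsProbabilityMeasure (P.map p) := Measure.isProbabilityMeasure_map hp.aemeasurable
    have : IsProbabilityMeasure (P.map fun ω => (p ω, Y ω)) :=
      Measure.isProbabilityMeasure_map hpY.aemeasurable
    refine Measure.ext_prod fun {B A} hB hA => ?_
    rw [Measure.map_apply hpY (hB.prod hA), withDensity_apply _ (hB.prod hA),
      setLIntegral_prod _ hg.aemeasurable, setLIntegral_map hB _ hp]
    · exact hrect B A hB hA
    · exact Measurable.lintegral_prod_right' (ν := ν.restrict A) hg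
  rw [← lintegral_map hΦ hpY, key, lintegral_withDensity_eq_lintegral_mul _ hg hΦ,
    lintegral_prod _ (hg.mul hΦ).aemeasurable, lintegral_map _ hp]
  · simp only [Pi.mul_apply, mul_comm]
  · exact Measurable.lintegral_prod_right' (hg.mul hΦ)

theorem naturalSigma_mono {Ω : Type*} {d : ℕ} (X : ℕ → Ω → Space d) {j k : ℕ} (h : j ≤ k) :
    naturalSigma X j ≤ naturalSigma X k :=
  biSup_mono fun _ hi => ⟨hi.1, hi.2.trans h⟩

theorem comap_le_naturalSigma {Ω : Type*} {d : ℕ} (X : ℕ → Ω → Space d) (k : ℕ) :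
    MeasurableSpace.comap (X (k + 1)) inferInstance ≤ naturalSigma X (k + 1) :=
  le_biSup (fun i => MeasurableSpace.comap (X i) inferInstance)
    (show k + 1 ∈ Set.Icc 1 (k + 1) from ⟨by omega, le_rfl⟩)

section Policy

variable {Ω : Type*} [mΩ : MeasurableSpace Ω] {d : ℕ} {P : Measure Ω}
  {X : ℕ → Ω → Space d} {q : ℕ → Ω → Space d → ℝ}

theorem IsPolicy.naturalSigma_le (hq : IsPolicy P X q) (k : ℕ) : naturalSigma X k ≤ mΩ := by
  refine iSup₂_le fun i hi => ?_
  obtain ⟨j, rfl⟩ : ∃ j, i = j + 1 := ⟨i - 1, by have := hi.1; omega⟩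
  exact (hq.measurable_particle j).comap_le

theorem IsPolicy.measurable_ofReal (hq : IsPolicy P X q) (k : ℕ) :
    Measurable[MeasurableSpace.prod (naturalSigma X k) inferInstance]
      (fun p : Ω × Space d => ENNReal.ofReal (q k p.1 p.2)) :=
  ENNReal.measurable_ofReal.comp (hq.adapted k)

/-- The conditional law is only known set by set, each with its own null set. Integrating over
events of `F_k` removes the null sets, and rectangles determine the joint law of the past and the
new particle. -/
theorem IsPolicy.lintegral_particle [IsProbabilityMeasure P] (hq : IsPolicy P X q) (k : ℕ)
    {Φ : Ω → Space d → ENNReal}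
    (hΦ : Measurable[MeasurableSpace.prod (naturalSigma X k) inferInstance]
      (fun p : Ω × Space d => Φ p.1 p.2)) :
    ∫⁻ ω, Φ ω (X (k + 1) ω) ∂P = ∫⁻ ω, (∫⁻ x, Φ ω x * ENNReal.ofReal (q k ω x)) ∂P := by
  have hle := hq.naturalSigma_le k
  have hX := hq.measurable_particle k
  refine @lintegral_comp_prodMk_of_rectangles Ω Ω (Space d) mΩ (naturalSigma X k) _ P _ volume _
    id (measurable_id'' hle) (X (k + 1)) hX _ (hq.measurable_ofReal k) ?_ _ hΦ
  intro B A hB hA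
  simp only [Set.preimage_id, id]
  have hBm : MeasurableSet B := hle _ hB
  have hXA : MeasurableSet (X (k + 1) ⁻¹' A) := hX hA
  have hint : Integrable ((X (k + 1) ⁻¹' A).indicator fun _ => (1 : ℝ)) P :=
    (integrable_const 1).indicator hXA
  have h1 : ∫ ω in B, (X (k + 1) ⁻¹' A).indicator (fun _ => (1 : ℝ)) ω ∂P
      = ∫ ω in B, (∫ x in A, q k ω x) ∂P := by
    rw [← setIntegral_condExp hle hint hB]
    exact setIntegral_congr_ae hBm ((hq.condLaw k A hA).mono fun ω h _ => h)
  have hIint : Integrable (fun ω => ∫ x in A, q k ω x) P :=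
    (integrable_condExp (m := naturalSigma X k)).congr (hq.condLaw k A hA)
  have h2 : ENNReal.ofReal (∫ ω in B, (∫ x in A, q k ω x) ∂P)
      = ∫⁻ ω in B, (∫⁻ x in A, ENNReal.ofReal (q k ω x)) ∂P := by
    rw [ofReal_integral_eq_lintegral_ofReal hIint.integrableOn
      (Eventually.of_forall fun ω => integral_nonneg fun x => (hq.density k ω).nonneg x)]
    refine lintegral_congr fun ω => ?_
    exact ofReal_integral_eq_lintegral_ofReal (hq.density k ω).integrable.integrableOn
      (Eventually.of_forall fun x => (hq.density k ω).nonneg x)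
  rw [← h2, ← h1, integral_indicator hXA]
  simp [Measure.restrict_apply, hXA, measureReal_def, Set.inter_comm]

/-- Each factor is divided by its own conditional mean, so the product is a supermartingale for
every choice of `e`. No bound on the conditional means is needed, so random conditions on the policy
can be imposed later without a stopping time. -/
theorem IsPolicy.lintegral_prod_div_le_one [IsProbabilityMeasure P] (hq : IsPolicy P X q)
    {e : ℕ → Ω → Space d → ENNReal}
    (he : ∀ k, Measurable[MeasurableSpace.prod (naturalSigma X k) inferInstance]
      (fun p : Ω × Space d => e k p.1 p.2)) (n : ℕ) :
    Measurable[naturalSigma X n] (fun ω => ∏ k ∈ Finset.range n,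
        e k ω (X (k + 1) ω) / ∫⁻ x, e k ω x * ENNReal.ofReal (q k ω x)) ∧
    ∫⁻ ω, ∏ k ∈ Finset.range n,
      (e k ω (X (k + 1) ω) / ∫⁻ x, e k ω x * ENNReal.ofReal (q k ω x)) ∂P ≤ 1 := by
  have hZ : ∀ k, Measurable[naturalSigma X k]
      (fun ω => ∫⁻ x, e k ω x * ENNReal.ofReal (q k ω x)) := fun k =>
    @Measurable.lintegral_prod_right' Ω (Space d) (naturalSigma X k) _ volume _
      (fun p => e k p.1 p.2 * ENNReal.ofReal (q k p.1 p.2))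
      ((he k).mul (hq.measurable_ofReal k))
  induction n with
  | zero => simp
  | succ n ih =>
    obtain ⟨ihm, ihl⟩ := ih
    have hmono := naturalSigma_mono X (Nat.le_succ n)
    have hpair : @Measurable _ _ (naturalSigma X (n + 1))
        (MeasurableSpace.prod (naturalSigma X n) inferInstance) (fun ω => (ω, X (n + 1) ω)) :=
      Measurable.prodMk (measurable_id'' hmono)
        (measurable_iff_comap_le.2 (comap_le_naturalSigma X n))
    refine ⟨?_, ?_⟩
    · simp only [Finset.prod_range_succ]
      exact (ihm.mono hmono le_rfl).mul
        (((he n).comp hpair).div ((hZ n).mono hmono le_rfl))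
    · simp only [Finset.prod_range_succ]
      set M : Ω → ENNReal := fun ω => ∏ k ∈ Finset.range n,
        (e k ω (X (k + 1) ω) / ∫⁻ x, e k ω x * ENNReal.ofReal (q k ω x)) with hM
      set Z : Ω → ENNReal := fun ω => ∫⁻ x, e n ω x * ENNReal.ofReal (q n ω x) with hZdef
      have hfst : @Measurable _ _ (MeasurableSpace.prod (naturalSigma X n) inferInstance)
        (naturalSigma X n) (fun p : Ω × Space d => p.1) :=
        @measurable_fst _ _ (naturalSigma X n) _
      have hfun := hq.lintegral_particle n (Φ := fun ω x => M ω * (e n ω x / Z ω))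
        ((ihm.comp hfst).mul ((he n).div ((hZ n).comp hfst)))
      refine hfun.trans_le (le_trans (lintegral_mono fun ω => ?_) ihl)
      have hsec : Measurable fun x => e n ω x * ENNReal.ofReal (q n ω x) := by
        have h1 : @Measurable _ _ _ (MeasurableSpace.prod (naturalSigma X n) inferInstance)
          (fun x : Space d => (ω, x)) := @measurable_prodMk_left _ _ (naturalSigma X n) _ ω
        exact ((he n).comp h1).mul ((hq.measurable_ofReal n).comp h1)
      calc ∫⁻ x, M ω * (e n ω x / Z ω) * ENNReal.ofReal (q n ω x)
          = ∫⁻ x, (M ω * (Z ω)⁻¹) * (e n ω x * ENNReal.ofReal (q n ω x)) := by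
            refine lintegral_congr fun x => ?_
            rw [div_eq_mul_inv]; ring
        _ = M ω * (Z ω / Z ω) := by
            rw [lintegral_const_mul _ hsec, div_eq_mul_inv]; ring
        -- Only an inequality: the conditional mean may be zero or infinite.
        _ ≤ M ω * 1 := by gcongr; exact ENNReal.div_self_le_one
        _ = M ω := mul_one _

end Policy

/-! ### Freedman's inequality for importance sampling sums -/

/-- The importance sampling sum `∑_{k=1}^n W_k φ(X_k)`. -/
noncomputable def weightedSum {Ω : Type*} {d : ℕ} (fU : Space d → ℝ) (X : ℕ → Ω → Space d)
    (q : ℕ → Ω → Space d → ℝ) (n : ℕ) (ω : Ω) (φ : Space d → ℝ) : ℝ :=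
  ∑ k ∈ Finset.range n, fU (X (k + 1) ω) / q k ω (X (k + 1) ω) * φ (X (k + 1) ω)

/-- Exponential moment of a centred importance sampling term under the sampling density `g`. -/
theorem lintegral_exp_importance_le {d : ℕ} {fU g φ β : Space d → ℝ} {t V m : ℝ}
    (hfU : Integrable fU) (hg : IsDensity g) (hφ : Measurable φ) {c : ℝ} (hφc : ∀ x, |φ x| ≤ c)
    (hβ : ∀ x, 0 ≤ β x) (hβi : Integrable fun x => β x * φ x ^ 2) (hV : ∫ x, β x * φ x ^ 2 ≤ V)
    (hm : ∫ x, fU x * φ x = m) (hsq : ∀ x, fU x ^ 2 ≤ β x * g x)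
    (hone : ∀ x, |t * (fU x / g x * φ x - m)| ≤ 1) :
    ∫⁻ x, ENNReal.ofReal (Real.exp (t * (fU x / g x * φ x - m))) * ENNReal.ofReal (g x)
      ≤ ENNReal.ofReal (Real.exp (t ^ 2 * V)) := by
  have hfφ : Integrable fun x => fU x * φ x :=
    hfU.mul_bdd (c := c) hφ.aestronglyMeasurable (Eventually.of_forall hφc)
  -- This is `(1 + u + u²) * g` with `u` the exponent, expanded so that the ratio cancels against
  -- `g`, and with `(fU / g)² * g` replaced by its bound `β`.
  set ψ : Space d → ℝ := fun x => (1 - t * m + t ^ 2 * m ^ 2) * g x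
    + (t - 2 * t ^ 2 * m) * (fU x * φ x) + t ^ 2 * (β x * φ x ^ 2) with hψ
  have hψi : Integrable ψ := ((hg.integrable.const_mul _).add (hfφ.const_mul _)).add
    (hβi.const_mul _)
  have hle : ∀ x, Real.exp (t * (fU x / g x * φ x - m)) * g x ≤ ψ x := by
    intro x
    have hg0 := hg.nonneg x
    have hexp := (abs_le.1 (Real.abs_exp_sub_one_sub_id_le (hone x))).2
    set r := fU x / g x with hr
    -- Where `g` vanishes, `hsq` forces `fU` to vanish too, so division by zero costs no bias.
    have h1 : r * g x = fU x := by
      rcases eq_or_ne (g x) 0 with h | h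
      · have h2 := hsq x
        rw [h, mul_zero] at h2
        have : fU x = 0 := by nlinarith
        rw [h, this, mul_zero]
      · rw [hr, div_mul_cancel₀ _ h]
    have h2 : r ^ 2 * g x ≤ β x := by
      rcases hg0.eq_or_lt with h | h
      · rw [← h, mul_zero]; exact hβ x
      · have : r ^ 2 * g x = fU x ^ 2 / g x := by rw [hr]; field_simp
        rw [this, div_le_iff₀ h]; exact hsq x
    have h3 : r ^ 2 * g x * (t ^ 2 * φ x ^ 2) ≤ β x * (t ^ 2 * φ x ^ 2) :=
      mul_le_mul_of_nonneg_right h2 (by positivity)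
    calc Real.exp (t * (r * φ x - m)) * g x
        ≤ (1 + t * (r * φ x - m) + (t * (r * φ x - m)) ^ 2) * g x := by
          apply mul_le_mul_of_nonneg_right _ hg0; linarith
      _ = (1 - t * m + t ^ 2 * m ^ 2) * g x + (t - 2 * t ^ 2 * m) * ((r * g x) * φ x)
          + r ^ 2 * g x * (t ^ 2 * φ x ^ 2) := by ring
      _ ≤ ψ x := by rw [h1, hψ]; simp only; linarith
  have hψ0 : ∀ x, 0 ≤ ψ x := fun x =>
    (mul_nonneg (Real.exp_pos _).le (hg.nonneg x)).trans (hle x)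
  calc ∫⁻ x, ENNReal.ofReal (Real.exp (t * (fU x / g x * φ x - m))) * ENNReal.ofReal (g x)
      ≤ ∫⁻ x, ENNReal.ofReal (ψ x) := by
        refine lintegral_mono fun x => ?_
        rw [← ENNReal.ofReal_mul (Real.exp_pos _).le]
        exact ENNReal.ofReal_le_ofReal (hle x)
    _ = ENNReal.ofReal (∫ x, ψ x) :=
        (ofReal_integral_eq_lintegral_ofReal hψi (Eventually.of_forall hψ0)).symm
    _ ≤ ENNReal.ofReal (Real.exp (t ^ 2 * V)) := by
        apply ENNReal.ofReal_le_ofReal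
        -- The right side collapses to `1 - t²m² + t² ∫ β φ²`, at most `1 + t² V`.
        have : ∫ x, ψ x = (1 - t * m + t ^ 2 * m ^ 2) * 1 + (t - 2 * t ^ 2 * m) * m
            + t ^ 2 * ∫ x, β x * φ x ^ 2 := by
          have hfirst : Integrable fun x => (1 - t * m + t ^ 2 * m ^ 2) * g x
              + (t - 2 * t ^ 2 * m) * (fU x * φ x) :=
            (hg.integrable.const_mul _).add (hfφ.const_mul _)
          simp only [hψ]
          rw [integral_add hfirst (hβi.const_mul _),
            integral_add (hg.integrable.const_mul _) (hfφ.const_mul _),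
            integral_const_mul, integral_const_mul, integral_const_mul, hm, hg.integral_eq_one]
        have h4 := Real.add_one_le_exp (t ^ 2 * V)
        have h5 := mul_le_mul_of_nonneg_left hV (sq_nonneg t)
        nlinarith [sq_nonneg (t * m)]

/-- Freedman's inequality for importance sampling sums. -/
theorem IsPolicy.measure_weightedSum_le {Ω : Type*} [MeasurableSpace Ω] {d : ℕ} {P : Measure Ω}
    [IsProbabilityMeasure P] {X : ℕ → Ω → Space d} {q : ℕ → Ω → Space d → ℝ}
    (hq : IsPolicy P X q) {fU φ β : Space d → ℝ} {t V m : ℝ}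
    (hfUm : Measurable fU) (hfU : Integrable fU) (hφ : Measurable φ) {c : ℝ}
    (hφc : ∀ x, |φ x| ≤ c)
    (hβ : ∀ x, 0 ≤ β x) (hβi : Integrable fun x => β x * φ x ^ 2) (hV : ∫ x, β x * φ x ^ 2 ≤ V)
    (hm : ∫ x, fU x * φ x = m) (n : ℕ) (a : ℝ) :
    P {ω | (∀ k < n, ∀ x, fU x ^ 2 ≤ β x * q k ω x ∧ |t * (fU x / q k ω x * φ x - m)| ≤ 1) ∧
        a ≤ t * (weightedSum fU X q n ω φ - n * m)}
      ≤ ENNReal.ofReal (Real.exp (n * (t ^ 2 * V) - a)) := by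
  set e : ℕ → Ω → Space d → ENNReal := fun k ω x =>
    ENNReal.ofReal (Real.exp (t * (fU x / q k ω x * φ x - m))) with he
  have hem : ∀ k, Measurable[MeasurableSpace.prod (naturalSigma X k) inferInstance]
      (fun p : Ω × Space d => e k p.1 p.2) := by
    intro k
    have hsnd : @Measurable _ _ (MeasurableSpace.prod (naturalSigma X k) inferInstance) _
        (fun p : Ω × Space d => p.2) := @measurable_snd _ _ (naturalSigma X k) _
    exact (Real.measurable_exp.comp (((((hfUm.comp hsnd).div (hq.adapted k)).mul
      (hφ.comp hsnd)).sub_const m).const_mul t)).ennreal_ofReal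
  obtain ⟨hMm, hM⟩ := hq.lintegral_prod_div_le_one hem n
  set M : Ω → ENNReal := fun ω => ∏ k ∈ Finset.range n,
      (e k ω (X (k + 1) ω) / ∫⁻ x, e k ω x * ENNReal.ofReal (q k ω x)) with hMdef
  set b : ℝ := a - n * (t ^ 2 * V) with hb
  have hMm' : Measurable M := hMm.mono (hq.naturalSigma_le n) le_rfl
  have hmarkov := (mul_meas_ge_le_lintegral (μ := P) hMm' (ENNReal.ofReal (Real.exp b))).trans hM
  -- On the event every conditional mean is at most `exp (t² V)`, so the normalised product exceeds
  -- `exp b`. The event itself need not be measurable: its outer measure is bounded by that of a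
  -- measurable superset.
  have hsub : {ω | (∀ k < n, ∀ x, fU x ^ 2 ≤ β x * q k ω x ∧
      |t * (fU x / q k ω x * φ x - m)| ≤ 1) ∧ a ≤ t * (weightedSum fU X q n ω φ - n * m)}
      ⊆ {ω | ENNReal.ofReal (Real.exp b) ≤ M ω} := by
    rintro ω ⟨h1, h2⟩
    have h3 : ∀ k ∈ Finset.range n, ENNReal.ofReal (Real.exp
        (t * (fU (X (k + 1) ω) / q k ω (X (k + 1) ω) * φ (X (k + 1) ω) - m) - t ^ 2 * V))
        ≤ e k ω (X (k + 1) ω) / ∫⁻ x, e k ω x * ENNReal.ofReal (q k ω x) := by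
      intro k hk
      have hk' := h1 k (Finset.mem_range.1 hk)
      rw [Real.exp_sub, ENNReal.ofReal_div_of_pos (Real.exp_pos _)]
      exact ENNReal.div_le_div_left (lintegral_exp_importance_le hfU (hq.density k ω) hφ hφc hβ
        hβi hV hm (fun x => (hk' x).1) fun x => (hk' x).2) _
    refine le_trans ?_ (Finset.prod_le_prod' h3)
    rw [← ENNReal.ofReal_prod_of_nonneg fun _ _ => (Real.exp_pos _).le, ← Real.exp_sum]
    apply ENNReal.ofReal_le_ofReal
    apply Real.exp_le_exp.2
    rw [Finset.sum_sub_distrib, ← Finset.mul_sum, Finset.sum_sub_distrib]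
    simp only [Finset.sum_const, Finset.card_range, nsmul_eq_mul]
    unfold weightedSum at h2
    linarith
  refine (measure_mono hsub).trans ?_
  have hneg : (n * (t ^ 2 * V) - a) = -b := by rw [hb]; ring
  rw [hneg, Real.exp_neg, ENNReal.ofReal_inv_of_pos (Real.exp_pos _)]
  rw [ENNReal.le_inv_iff_mul_le, mul_comm]
  exact hmarkov

/-! ### Simultaneous deviations by union bound and Borel–Cantelli -/

section Deviation

variable {Ω : Type*} [MeasurableSpace Ω] {d : ℕ} {P : Measure Ω} [IsProbabilityMeasure P]
  {X : ℕ → Ω → Space d} {q : ℕ → Ω → Space d → ℝ} {fU G : Space d → ℝ}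

/-- Two-sided deviation bound for one test function, at the scale `a * √v`. -/
theorem IsPolicy.measure_deviation_le (hq : IsPolicy P X q) (hfUm : Measurable fU)
    (hfU0 : ∀ x, 0 ≤ fU x) (hfU : Integrable fU) (hG0 : ∀ x, 0 ≤ G x) (hG : Integrable G)
    {φ : Space d → ℝ} {n : ℕ} {a v l H C C₁ B A γ : ℝ} (hn : 2 ≤ n) (ha : 0 < a) (hH : 0 < H)
    (haH : n * a ^ 2 = Real.log n * H) (hv : 1 ≤ v) (hl : 0 < l) (hl1 : l ≤ 1)
    (hB : 0 ≤ B) (hC : 0 ≤ C) (hC₁ : 0 ≤ C₁)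
    (hal : (C₁ * C + C * ∫ x, fU x) * (a / l) ≤ 1)
    (hφm : Measurable φ) (hφ0 : ∀ x, 0 ≤ φ x) (hφ1 : ∀ x, φ x ≤ C * H)
    (hφ2 : ∫ x, G x * φ x ^ 2 ≤ C * H)
    (hw : ∀ k < n, ∀ ω x, fU x / q k ω x ≤ C₁ / l) (hA : B * C + γ ≤ A) :
    P {ω | (∀ k < n, ∀ x, fU x ^ 2 ≤ B * v * G x * q k ω x) ∧
        A * (a * √v) < |weightedSum fU X q n ω φ / n - ∫ x, fU x * φ x|}
      ≤ 2 * ENNReal.ofReal (Real.exp (-γ * Real.log n)) := by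
  set U := ∫ x, fU x with hU
  set m := ∫ x, fU x * φ x with hm
  have hU0 : 0 ≤ U := integral_nonneg hfU0
  have hn0 : (0 : ℝ) < n := by positivity
  have hL : 0 < Real.log n := Real.log_pos (by exact_mod_cast hn)
  have hs : 0 < √v := Real.sqrt_pos.2 (by linarith)
  have hs1 : 1 ≤ √v := by rw [Real.one_le_sqrt]; exact hv
  have hs2 : √v ^ 2 = v := Real.sq_sqrt (by linarith)
  -- With this `t` a deviation `A * a * √v` costs `A * log n` in the exponent, the variance term is
  -- `B * C * log n`, and `t * H = a / √v` keeps the jumps at order `a / l`.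
  set t : ℝ := Real.log n / (n * a * √v) with ht
  have ht0 : 0 < t := by positivity
  have htL : t * (n * (a * √v)) = Real.log n := by rw [ht]; field_simp
  have htH : t * H = a / √v := by
    rw [ht]; field_simp; linarith
  have htV : n * (t ^ 2 * (B * v * (C * H))) = B * C * Real.log n := by
    have : n * (t ^ 2 * (B * v * (C * H))) = B * C * (t * (n * (a * √v))) * ((t * H) * √v / a) := by
      rw [show B * v * (C * H) = B * √v ^ 2 * (C * H) by rw [hs2]]; field_simp
    rw [this, htL, htH]; field_simp
  have hCH : 0 ≤ C * H := by positivity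
  have habs : ∀ x, |φ x| ≤ C * H := fun x => by rw [abs_of_nonneg (hφ0 x)]; exact hφ1 x
  have hfφ : Integrable fun x => fU x * φ x :=
    hfU.mul_bdd (c := C * H) hφm.aestronglyMeasurable (Eventually.of_forall habs)
  have hm0 : 0 ≤ m := integral_nonneg fun x => mul_nonneg (hfU0 x) (hφ0 x)
  have hm1 : m ≤ C * H * U := by
    rw [hm, hU, ← integral_const_mul]
    refine integral_mono hfφ (hfU.const_mul _) fun x => ?_
    simp only
    rw [mul_comm]
    exact mul_le_mul_of_nonneg_right (hφ1 x) (hfU0 x)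
  have hjump : ∀ k < n, ∀ ω x, |t * (fU x / q k ω x * φ x - m)| ≤ 1 := by
    intro k hk ω x
    have hr0 : 0 ≤ fU x / q k ω x := div_nonneg (hfU0 x) ((hq.density k ω).nonneg x)
    have h1 : |fU x / q k ω x * φ x - m| ≤ (C₁ * C + C * U) * H / l := by
      have h2 : fU x / q k ω x * φ x ≤ C₁ / l * (C * H) :=
        mul_le_mul (hw k hk ω x) (hφ1 x) (hφ0 x) (by positivity)
      have h3 : C * H * U ≤ C * H * U / l := by
        rw [le_div_iff₀ hl]; exact mul_le_of_le_one_right (by positivity) hl1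
      have h4 : (C₁ * C + C * U) * H / l = C₁ / l * (C * H) + C * H * U / l := by ring
      have h5 : 0 ≤ C₁ / l * (C * H) := by positivity
      have h6 := mul_nonneg hr0 (hφ0 x)
      have h7 : 0 ≤ C * H * U / l := by positivity
      rw [abs_le]
      constructor <;> linarith
    calc |t * (fU x / q k ω x * φ x - m)| = t * |fU x / q k ω x * φ x - m| := by
          rw [abs_mul, abs_of_pos ht0]
      _ ≤ t * ((C₁ * C + C * U) * H / l) := by gcongr
      _ = (C₁ * C + C * U) * ((t * H) / l) := by ring
      _ ≤ (C₁ * C + C * U) * (a / l) := by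
          rw [htH]
          gcongr
          exact div_le_self ha.le hs1
      _ ≤ 1 := hal
  have hβi : Integrable fun x => B * v * G x * φ x ^ 2 := by
    refine (hG.const_mul _).mul_bdd (c := (C * H) ^ 2) (hφm.pow_const 2).aestronglyMeasurable
      (Eventually.of_forall fun x => ?_)
    rw [Real.norm_eq_abs, abs_pow]
    gcongr
    exact habs x
  have hβV : ∫ x, B * v * G x * φ x ^ 2 ≤ B * v * (C * H) := by
    have : ∀ x, B * v * G x * φ x ^ 2 = B * v * (G x * φ x ^ 2) := fun x => by ring
    simp only [this]
    rw [integral_const_mul]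
    gcongr
  have hβ0 : ∀ x, 0 ≤ B * v * G x := fun x => mul_nonneg (by positivity) (hG0 x)
  have hside : ∀ s : ℝ, s ^ 2 = t ^ 2 →
      P {ω | (∀ k < n, ∀ x, fU x ^ 2 ≤ B * v * G x * q k ω x ∧
        |s * (fU x / q k ω x * φ x - m)| ≤ 1) ∧
        A * Real.log n ≤ s * (weightedSum fU X q n ω φ - n * m)}
      ≤ ENNReal.ofReal (Real.exp (-γ * Real.log n)) := by
    intro s hs2
    refine (hq.measure_weightedSum_le (t := s) hfUm hfU hφm habs hβ0 hβi hβV hm.symm n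
      (A * Real.log n)).trans (ENNReal.ofReal_le_ofReal (Real.exp_le_exp.2 ?_))
    rw [hs2, htV]
    nlinarith
  have hsub : {ω | (∀ k < n, ∀ x, fU x ^ 2 ≤ B * v * G x * q k ω x) ∧
        A * (a * √v) < |weightedSum fU X q n ω φ / n - m|} ⊆
      {ω | (∀ k < n, ∀ x, fU x ^ 2 ≤ B * v * G x * q k ω x ∧
        |t * (fU x / q k ω x * φ x - m)| ≤ 1) ∧
        A * Real.log n ≤ t * (weightedSum fU X q n ω φ - n * m)} ∪
      {ω | (∀ k < n, ∀ x, fU x ^ 2 ≤ B * v * G x * q k ω x ∧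
        |-t * (fU x / q k ω x * φ x - m)| ≤ 1) ∧
        A * Real.log n ≤ -t * (weightedSum fU X q n ω φ - n * m)} := by
    rintro ω ⟨h1, h2⟩
    have h3 : weightedSum fU X q n ω φ / n - m = (weightedSum fU X q n ω φ - n * m) / n := by
      field_simp
    rw [h3] at h2
    have h4 : ∀ y : ℝ, A * (a * √v) < y / n → A * Real.log n ≤ t * y := by
      intro y hy
      rw [lt_div_iff₀ hn0] at hy
      rw [← htL]
      nlinarith
    rcases lt_abs.1 h2 with h | h
    · exact Or.inl ⟨fun k hk x => ⟨h1 k hk x, hjump k hk ω x⟩, h4 _ h⟩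
    · refine Or.inr ⟨fun k hk x => ⟨h1 k hk x, ?_⟩, ?_⟩
      · rw [neg_mul, abs_neg]; exact hjump k hk ω x
      · rw [← neg_div] at h
        have := h4 _ h
        linarith
  refine (measure_mono hsub).trans ((measure_union_le _ _).trans ?_)
  rw [two_mul]
  exact add_le_add (hside t rfl) (hside (-t) (neg_sq t))

/-- Almost surely, eventually all the test functions of a polynomially large family have
deviations of order `a n * √(v n)`. -/
theorem IsPolicy.eventually_deviation_le (hq : IsPolicy P X q) (hfUm : Measurable fU)
    (hfU0 : ∀ x, 0 ≤ fU x) (hfU : Integrable fU) (hG0 : ∀ x, 0 ≤ G x) (hG : Integrable G)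
    {ι : Type*} {I : ℕ → Finset ι} {φ : ℕ → ι → Space d → ℝ} {a v l H : ℕ → ℝ} {C C₁ : ℝ} {γ : ℕ}
    (hC : 0 ≤ C) (hC₁ : 0 ≤ C₁) (hI : ∀ᶠ n in atTop, (I n).card ≤ n ^ γ)
    (hscale : ∀ᶠ n in atTop, 0 < a n ∧ 0 < H n ∧ n * a n ^ 2 = Real.log n * H n ∧ 1 ≤ v n ∧
      0 < l n ∧ l n ≤ 1)
    (hal : Tendsto (fun n => a n / l n) atTop (𝓝 0))
    (hφ : ∀ᶠ n in atTop, ∀ i ∈ I n, Measurable (φ n i) ∧ (∀ x, 0 ≤ φ n i x) ∧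
      (∀ x, φ n i x ≤ C * H n) ∧ ∫ x, G x * φ n i x ^ 2 ≤ C * H n)
    (hw : ∀ᶠ n in atTop, ∀ k < n, ∀ ω x, fU x / q k ω x ≤ C₁ / l n) (B : ℕ) :
    ∃ A : ℝ, 0 ≤ A ∧ ∀ᵐ ω ∂P, ∀ᶠ n in atTop,
      (∀ k < n, ∀ x, fU x ^ 2 ≤ B * v n * G x * q k ω x) →
      ∀ i ∈ I n, |weightedSum fU X q n ω (φ n i) / n - ∫ x, fU x * φ n i x| ≤ A * (a n * √(v n)) := by
  -- `B * C` pays for the variance, and `γ + 2` makes `n^γ` events of probability at most `2 /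
  -- n^(γ+2)` summable.
  set A : ℝ := B * C + (γ + 2 : ℕ) with hA
  refine ⟨A, by positivity, ?_⟩
  have hal' : ∀ᶠ n in atTop, (C₁ * C + C * ∫ x, fU x) * (a n / l n) ≤ 1 := by
    have := (hal.const_mul (C₁ * C + C * ∫ x, fU x))
    rw [mul_zero] at this
    exact this.eventually (eventually_le_nhds one_pos)
  have hgood := hI.and (hscale.and (hal'.and (hφ.and (hw.and (eventually_ge_atTop 2)))))
  obtain ⟨N, hN⟩ := eventually_atTop.1 hgood
  set bad : ℕ → Ω → Prop := fun n ω => N ≤ n ∧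
    ((∀ k < n, ∀ x, fU x ^ 2 ≤ B * v n * G x * q k ω x) ∧ ∃ i ∈ I n,
      A * (a n * √(v n)) < |weightedSum fU X q n ω (φ n i) / n - ∫ x, fU x * φ n i x|) with hbad
  have hmeas : ∀ n, P {ω | bad n ω} ≤ ENNReal.ofReal (2 * (1 / (n : ℝ) ^ 2)) := by
    intro n
    by_cases hn : N ≤ n
    · obtain ⟨h1, ⟨ha, hH, haH, hv, hl, hl1⟩, h3, h4, h5, h6⟩ := hN n hn
      have hn0 : (0 : ℝ) < n := by positivity
      have hsub : {ω | bad n ω} ⊆ ⋃ i ∈ I n, {ω |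
          (∀ k < n, ∀ x, fU x ^ 2 ≤ B * v n * G x * q k ω x) ∧
          A * (a n * √(v n)) < |weightedSum fU X q n ω (φ n i) / n - ∫ x, fU x * φ n i x|} := by
        rintro ω ⟨-, h, i, hi, hi'⟩
        exact Set.mem_biUnion hi ⟨h, hi'⟩
      have hexp : Real.exp (-((γ + 2 : ℕ) : ℝ) * Real.log n) = 1 / (n : ℝ) ^ (γ + 2) := by
        rw [neg_mul, Real.exp_neg, ← Real.log_pow, Real.exp_log (by positivity), one_div]
      calc P {ω | bad n ω}
          ≤ ∑ i ∈ I n, P {ω | (∀ k < n, ∀ x, fU x ^ 2 ≤ B * v n * G x * q k ω x) ∧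
          A * (a n * √(v n)) < |weightedSum fU X q n ω (φ n i) / n - ∫ x, fU x * φ n i x|} :=
            (measure_mono hsub).trans (measure_biUnion_finset_le _ _)
        _ ≤ ∑ i ∈ I n, 2 * ENNReal.ofReal (1 / (n : ℝ) ^ (γ + 2)) := by
            refine Finset.sum_le_sum fun i hi => ?_
            obtain ⟨p1, p2, p3, p4⟩ := h4 i hi
            rw [← hexp]
            exact hq.measure_deviation_le hfUm hfU0 hfU hG0 hG h6 ha hH haH hv hl hl1
              (Nat.cast_nonneg B) hC hC₁ h3 p1 p2 p3 p4 h5 le_rfl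
        _ ≤ ENNReal.ofReal (2 * (1 / (n : ℝ) ^ 2)) := by
            have h2 : (2 : ENNReal) = ENNReal.ofReal 2 := by simp
            rw [Finset.sum_const, nsmul_eq_mul, h2, ← ENNReal.ofReal_mul (by norm_num),
              ← ENNReal.ofReal_natCast, ← ENNReal.ofReal_mul (by positivity)]
            apply ENNReal.ofReal_le_ofReal
            have h7 : ((I n).card : ℝ) ≤ (n : ℝ) ^ γ := by exact_mod_cast h1
            calc ((I n).card : ℝ) * (2 * (1 / (n : ℝ) ^ (γ + 2)))
                ≤ (n : ℝ) ^ γ * (2 * (1 / (n : ℝ) ^ (γ + 2))) := by gcongr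
              _ = 2 * (1 / (n : ℝ) ^ 2) := by rw [pow_add]; field_simp
    · have : {ω | bad n ω} = ∅ := Set.eq_empty_of_forall_notMem fun ω h => hn h.1
      rw [this]; simp
  have hsum : ∑' n, P {ω | bad n ω} ≠ ⊤ := by
    refine ne_top_of_le_ne_top ?_ (ENNReal.tsum_le_tsum hmeas)
    exact ((Real.summable_one_div_nat_pow.2 one_lt_two).mul_left 2).tsum_ofReal_ne_top
  have hae : ∀ᵐ ω ∂P, ¬ ∃ᶠ n in atTop, bad n ω :=
    ae_iff.2 (by simpa only [not_not] using measure_setOfPred_frequently_eq_zero hsum)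
  filter_upwards [hae] with ω hω
  rw [not_frequently] at hω
  filter_upwards [hω, eventually_ge_atTop N] with n h1 h2 h3 i hi
  by_contra hcon
  exact h1 ⟨h2, h3, i, hi, not_le.1 hcon⟩

end Deviation

/-! ### Rescaled kernels, Taylor expansion and bias -/

section Kernel

variable {d : ℕ} {K : Space d → ℝ}

theorem AdmissibleKernel.scaledKernel_nonneg (hK : AdmissibleKernel K) {h : ℝ} (hh : 0 < h)
    (u : Space d) : 0 ≤ scaledKernel K h u :=
  div_nonneg (hK.density.nonneg _) (pow_nonneg hh.le _)

theorem AdmissibleKernel.measurable_scaledKernel (hK : AdmissibleKernel K) (h : ℝ) (x : Space d) :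
    Measurable fun y => scaledKernel K h (x - y) := by
  unfold scaledKernel
  exact (hK.density.measurable.comp
    ((measurable_const.sub measurable_id).const_smul h⁻¹)).div_const _

theorem AdmissibleKernel.exists_bound (hK : AdmissibleKernel K) :
    ∃ C : ℝ, 0 < C ∧ ∀ u, K u ≤ C := by
  obtain ⟨C, r, hC, hr, h⟩ := hK.tail
  refine ⟨C, hC, fun u => (h u).trans ?_⟩
  refine mul_le_of_le_one_right hC.le ?_
  exact Real.rpow_le_one_of_one_le_of_nonpos (by linarith [norm_nonneg u]) (by linarith)

/-- For bandwidths at most one, rescaling only moves the argument away from the origin, so the decay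
of `K` carries over up to the factor `h^(-d)`. -/
theorem AdmissibleKernel.exists_tail_bound (hK : AdmissibleKernel K) :
    ∃ C r : ℝ, 0 < C ∧ 0 < r ∧ ∀ h : ℝ, 0 < h → h ≤ 1 → ∀ R : ℝ, 0 < R → ∀ u : Space d, R ≤ ‖u‖ →
      scaledKernel K h u ≤ C * R ^ (-r) * (h ^ d)⁻¹ := by
  obtain ⟨C, r, hC, hr, h⟩ := hK.tail
  refine ⟨C, r, hC, hr, fun b hb hb1 R hR u hu => ?_⟩
  have h1 : R ≤ 1 + ‖b⁻¹ • u‖ := by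
    rw [norm_smul, norm_inv, Real.norm_eq_abs, abs_of_pos hb]
    have : 1 ≤ b⁻¹ := (one_le_inv₀ hb).2 hb1
    nlinarith [norm_nonneg u]
  have h2 : (1 + ‖b⁻¹ • u‖) ^ (-r) ≤ R ^ (-r) :=
    Real.rpow_le_rpow_of_nonpos hR h1 (by linarith)
  rw [scaledKernel, div_eq_mul_inv]
  exact mul_le_mul_of_nonneg_right ((h _).trans (mul_le_mul_of_nonneg_left h2 hC.le))
    (inv_nonneg.2 (pow_pos hb d).le)

theorem AdmissibleKernel.exists_lipschitz_bound (hK : AdmissibleKernel K) :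
    ∃ L : ℝ, 0 ≤ L ∧ ∀ h : ℝ, 0 < h → ∀ u v : Space d,
      |scaledKernel K h u - scaledKernel K h v| ≤ L * (h⁻¹ * (h ^ d)⁻¹) * ‖u - v‖ := by
  obtain ⟨L, hL⟩ := hK.lipschitz
  refine ⟨L, L.2, fun h hh u v => ?_⟩
  have h1 := hL.dist_le_mul (h⁻¹ • u) (h⁻¹ • v)
  rw [Real.dist_eq, dist_eq_norm, ← smul_sub, norm_smul, norm_inv, Real.norm_eq_abs,
    abs_of_pos hh] at h1
  unfold scaledKernel
  rw [← sub_div, abs_div, abs_of_pos (pow_pos hh d), div_le_iff₀ (pow_pos hh d)]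
  calc _ ≤ L * (h⁻¹ * ‖u - v‖) := h1
    _ = _ := by field_simp

/-- Substitution `y = x - h u` against the rescaled kernel. -/
theorem integral_mul_scaledKernel (K : Space d → ℝ) {h : ℝ} (hh : 0 < h) (g : Space d → ℝ)
    (x : Space d) : ∫ y, g y * scaledKernel K h (x - y) = ∫ u, g (x - h • u) * K u := by
  have h1 : ∫ y, g y * scaledKernel K h (x - y) = ∫ u, g (x - u) * scaledKernel K h u := by
    rw [← integral_sub_left_eq_self (fun u => g (x - u) * scaledKernel K h u) volume x]
    simp
  have h2 := Measure.integral_comp_inv_smul (volume : Measure (Space d))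
    (fun u => g (x - h • u) * K u) h
  rw [h1]
  have h3 : ∀ u, g (x - u) * scaledKernel K h u
      = (h ^ d)⁻¹ * (g (x - h • h⁻¹ • u) * K (h⁻¹ • u)) := by
    intro u
    rw [smul_inv_smul₀ hh.ne', scaledKernel]
    ring
  simp only [h3]
  rw [integral_const_mul, h2, finrank_euclideanSpace_fin, abs_of_pos (pow_pos hh d), smul_eq_mul,
    inv_mul_cancel_left₀ (pow_pos hh d).ne']

theorem AdmissibleKernel.integral_scaledKernel (hK : AdmissibleKernel K) {h : ℝ} (hh : 0 < h)
    (x : Space d) : ∫ y, scaledKernel K h (x - y) = 1 := by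
  have := integral_mul_scaledKernel K hh (fun _ => 1) x
  simp only [one_mul] at this
  rw [this, hK.density.integral_eq_one]

/-- The integral equals one, whereas a non-integrable function has integral zero by convention. -/
theorem AdmissibleKernel.integrable_scaledKernel (hK : AdmissibleKernel K) {h : ℝ} (hh : 0 < h)
    (x : Space d) : Integrable fun y => scaledKernel K h (x - y) :=
  Integrable.of_integral_ne_zero (by rw [hK.integral_scaledKernel hh x]; exact one_ne_zero)

end Kernel

/-- A Taylor bound for `C²` functions with bounded second derivative. -/
theorem SmoothTarget.exists_taylor_bound {d : ℕ} {f : Space d → ℝ} (hf : SmoothTarget f) :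
    ∃ C : ℝ, 0 ≤ C ∧ ∀ x y, |f y - f x - fderiv ℝ f x (y - x)| ≤ C * ‖y - x‖ ^ 2 := by
  obtain ⟨C, hC⟩ := hf.bounded_second
  have hC0 : 0 ≤ C := (norm_nonneg _).trans (hC 0)
  have hd : Differentiable ℝ f := hf.contDiff.differentiable (by norm_num)
  have hd2 : Differentiable ℝ (fderiv ℝ f) :=
    (hf.contDiff.fderiv_right (m := 1) (by norm_num)).differentiable (by norm_num)
  have hb : ∀ x, ‖fderiv ℝ (fderiv ℝ f) x‖ ≤ C := by
    intro x
    have h1 := hC x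
    have h2 : ‖iteratedFDeriv ℝ 2 f x‖ = ‖iteratedFDeriv ℝ 1 (fderiv ℝ f) x‖ :=
      (norm_iteratedFDeriv_fderiv (n := 1)).symm
    have h3 : ‖iteratedFDeriv ℝ 1 (fderiv ℝ f) x‖ = ‖fderiv ℝ (fderiv ℝ f) x‖ := by
      rw [← norm_iteratedFDeriv_fderiv (n := 0), norm_iteratedFDeriv_zero]
    rwa [h2, h3] at h1
  have hlip : ∀ x y, ‖fderiv ℝ f y - fderiv ℝ f x‖ ≤ C * ‖y - x‖ := fun x y =>
    Convex.norm_image_sub_le_of_norm_fderiv_le (𝕜 := ℝ) (fun z _ => hd2 z) (fun z _ => hb z)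
      convex_univ (Set.mem_univ x) (Set.mem_univ y)
  refine ⟨C, hC0, fun x y => ?_⟩
  -- Mean value inequality on the segment, comparing the derivative with its value at `x`; the two
  -- differ by at most `C * ‖y - x‖` there.
  have := Convex.norm_image_sub_le_of_norm_hasFDerivWithin_le' (𝕜 := ℝ) (f := f)
    (f' := fderiv ℝ f) (C := C * ‖y - x‖) (s := segment ℝ x y) (x := x) (y := y)
    (φ := fderiv ℝ f x) (fun z _ => (hd z).hasFDerivAt.hasFDerivWithinAt)
    (fun z hz => (hlip x z).trans ?_) (convex_segment x y) (left_mem_segment ℝ x y)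
    (right_mem_segment ℝ x y)
  · rw [Real.norm_eq_abs] at this
    calc _ ≤ _ := this
      _ = _ := by ring
  · gcongr
    obtain ⟨θ, ⟨h0, h1⟩, rfl⟩ := (segment_eq_image' ℝ x y) ▸ hz
    simp only [add_sub_cancel_left, norm_smul, Real.norm_eq_abs, abs_of_nonneg h0]
    exact mul_le_of_le_one_left (norm_nonneg _) h1

/-- The bias of the kernel smoothing is of order `h ^ 2`. -/
theorem exists_bias_bound {d : ℕ} {f K : Space d → ℝ} (hf : SmoothTarget f)
    (hK : AdmissibleKernel K) :
    ∃ C : ℝ, 0 ≤ C ∧ ∀ h : ℝ, 0 < h → ∀ x,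
      |(∫ y, f y * scaledKernel K h (x - y)) - f x| ≤ C * h ^ 2 := by
  obtain ⟨C, hC0, hC⟩ := hf.exists_taylor_bound
  refine ⟨C * ∫ u, ‖u‖ ^ 2 * K u, mul_nonneg hC0 (integral_nonneg fun u =>
    mul_nonneg (sq_nonneg _) (hK.density.nonneg u)), fun h hh x => ?_⟩
  -- The first moment is controlled by the zeroth and second, and must be finite for centring to
  -- cancel the linear Taylor term.
  have hfirst : Integrable fun u : Space d => K u • u := by
    refine (hK.density.integrable.add hK.second_moment).mono
      (hK.density.measurable.smul measurable_id).aestronglyMeasurable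
      (Eventually.of_forall fun u => ?_)
    have h0 := hK.density.nonneg u
    simp only [Pi.add_apply]
    rw [norm_smul, Real.norm_eq_abs, Real.norm_eq_abs, abs_of_nonneg h0, abs_of_nonneg (by positivity)]
    nlinarith [sq_nonneg (‖u‖ - 1), norm_nonneg u]
  set D := fderiv ℝ f x with hD
  have hDint : Integrable fun u => D (K u • u) := D.integrable_comp hfirst
  have hD0 : ∫ u, D (K u • u) = 0 := by
    rw [D.integral_comp_comm hfirst, hK.centred, map_zero]
  set ρ : Space d → ℝ := fun u => (f (x - h • u) - f x - D (x - h • u - x)) * K u with hρ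
  have hρb : ∀ u, |ρ u| ≤ C * h ^ 2 * (‖u‖ ^ 2 * K u) := by
    intro u
    have h0 := hK.density.nonneg u
    have h1 := hC x (x - h • u)
    have h2 : ‖x - h • u - x‖ = h * ‖u‖ := by
      rw [sub_sub_cancel_left, norm_neg, norm_smul, Real.norm_eq_abs, abs_of_pos hh]
    rw [hρ]; simp only
    rw [abs_mul, abs_of_nonneg h0]
    rw [h2] at h1
    calc _ ≤ C * (h * ‖u‖) ^ 2 * K u := by gcongr
      _ = _ := by ring
  have hcont : Continuous f := hf.contDiff.continuous
  have hρm : Measurable ρ := by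
    have : Measurable fun u : Space d => f (x - h • u) - f x - D (x - h • u - x) :=
      Continuous.measurable (by fun_prop)
    exact this.mul hK.density.measurable
  have hρi : Integrable ρ := (hK.second_moment.const_mul (C * h ^ 2)).mono' hρm.aestronglyMeasurable
    (Eventually.of_forall hρb)
  have hdec : ∀ u, f (x - h • u) * K u = ρ u + (f x * K u + (-h) * D (K u • u)) := by
    intro u
    rw [hρ]; simp only [sub_sub_cancel_left, map_neg, map_smul, smul_eq_mul]
    ring
  have hint : ∫ u, f (x - h • u) * K u = (∫ u, ρ u) + f x := by
    simp only [hdec]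
    have hrest : Integrable fun u => f x * K u + (-h) * D (K u • u) :=
      (hK.density.integrable.const_mul _).add (hDint.const_mul _)
    rw [integral_add hρi hrest,
      integral_add (hK.density.integrable.const_mul _) (hDint.const_mul _),
      integral_const_mul, integral_const_mul, hD0, hK.density.integral_eq_one]
    ring
  rw [integral_mul_scaledKernel K hh, hint, add_sub_cancel_right]
  calc |∫ u, ρ u| ≤ ∫ u, |ρ u| := abs_integral_le_integral_abs
    _ ≤ ∫ u, C * h ^ 2 * (‖u‖ ^ 2 * K u) :=
        integral_mono hρi.abs (hK.second_moment.const_mul _) hρb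
    _ = C * (∫ u, ‖u‖ ^ 2 * K u) * h ^ 2 := by rw [integral_const_mul]; ring

/-! ### Powers of the target: integrability and tails -/

section Target

variable {d : ℕ} {f q0 : Space d → ℝ}

theorem SafeDensity.exists_le_mul (h : SafeDensity f q0) : ∃ c : ℝ, 0 < c ∧ ∀ x, f x ≤ c * q0 x := by
  obtain ⟨c, hc, h1⟩ := h.dominates 1 one_pos le_rfl
  exact ⟨c, hc, fun x => by simpa using h1 x⟩

theorem SafeDensity.exists_target_tail (h : SafeDensity f q0) :
    ∃ C r : ℝ, 0 < C ∧ 0 < r ∧ ∀ x, f x ≤ C * (1 + ‖x‖) ^ (-r) := by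
  obtain ⟨c, hc, h1⟩ := h.exists_le_mul
  obtain ⟨C, r, hC, hr, h2⟩ := h.tail
  refine ⟨c * C, r, by positivity, hr, fun x => (h1 x).trans ?_⟩
  rw [mul_assoc]
  gcongr
  exact h2 x

theorem SafeDensity.exists_target_bound (h : SafeDensity f q0) :
    ∃ M : ℝ, 0 < M ∧ ∀ x, f x ≤ M := by
  obtain ⟨C, r, hC, hr, h⟩ := h.exists_target_tail
  refine ⟨C, hC, fun u => (h u).trans ?_⟩
  refine mul_le_of_le_one_right hC.le ?_
  exact Real.rpow_le_one_of_one_le_of_nonpos (by linarith [norm_nonneg u]) (by linarith)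

theorem SafeDensity.integrable_rpow (h : SafeDensity f q0) (hf : IsDensity f) {κ : ℝ} (hκ : 0 < κ)
    (hκ1 : κ ≤ 1) : Integrable fun x => f x ^ κ := by
  obtain ⟨c, hc, h1⟩ := h.dominates κ hκ hκ1
  refine (h.density.integrable.const_mul c).mono' (hf.measurable.pow_const κ).aestronglyMeasurable
    (Eventually.of_forall fun x => ?_)
  rw [Real.norm_eq_abs, abs_of_nonneg (Real.rpow_nonneg (hf.nonneg x) κ)]
  exact h1 x

/-- Powers of the target have polynomially decaying tail integrals. -/
theorem SafeDensity.exists_tail_integral_bound (h : SafeDensity f q0) (hf : IsDensity f) {κ : ℝ}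
    (hκ : 0 < κ) (hκ1 : κ ≤ 1) :
    ∃ C s : ℝ, 0 < C ∧ 0 < s ∧ ∀ R : ℝ, 0 < R →
      ∫ x in {x | R < ‖x‖}, f x ^ κ ≤ C * R ^ (-s) := by
  obtain ⟨C, r, hC, hr, h1⟩ := h.exists_target_tail
  -- Half of the exponent gives decay in `R`, the other half integrability through `q0`.
  obtain ⟨c, hc, h2⟩ := h.dominates (κ / 2) (by linarith) (by linarith)
  refine ⟨c * C ^ (κ / 2), r * (κ / 2), by positivity, by positivity, fun R hR => ?_⟩
  have hmeas : MeasurableSet {x : Space d | R < ‖x‖} :=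
    measurableSet_lt measurable_const measurable_norm
  calc ∫ x in {x | R < ‖x‖}, f x ^ κ
      ≤ ∫ x in {x | R < ‖x‖}, c * C ^ (κ / 2) * R ^ (-(r * (κ / 2))) * q0 x := by
        refine setIntegral_mono_on (h.integrable_rpow hf hκ hκ1).integrableOn
          (h.density.integrable.const_mul _).integrableOn hmeas fun x hx => ?_
        have hx : R < ‖x‖ := hx
        have h3 : f x ^ (κ / 2) ≤ C ^ (κ / 2) * R ^ (-(r * (κ / 2))) := by
          have h4 : f x ≤ C * R ^ (-r) := (h1 x).trans (mul_le_mul_of_nonneg_left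
            (Real.rpow_le_rpow_of_nonpos hR (by linarith) (by linarith)) hC.le)
          calc f x ^ (κ / 2) ≤ (C * R ^ (-r)) ^ (κ / 2) :=
                Real.rpow_le_rpow (hf.nonneg x) h4 (by linarith)
            _ = C ^ (κ / 2) * R ^ (-(r * (κ / 2))) := by
                rw [Real.mul_rpow hC.le (by positivity), ← Real.rpow_mul hR.le]
                congr 2; ring
        calc f x ^ κ = f x ^ (κ / 2) * f x ^ (κ / 2) := by
              rw [← Real.rpow_add_of_nonneg (hf.nonneg x) (by linarith) (by linarith), add_halves]
          _ ≤ (c * q0 x) * (C ^ (κ / 2) * R ^ (-(r * (κ / 2)))) :=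
              mul_le_mul (h2 x) h3 (Real.rpow_nonneg (hf.nonneg x) _)
                (mul_nonneg hc.le (h.density.nonneg x))
          _ = _ := by ring
    _ = c * C ^ (κ / 2) * R ^ (-(r * (κ / 2))) * ∫ x in {x | R < ‖x‖}, q0 x :=
        integral_const_mul _ _
    _ ≤ c * C ^ (κ / 2) * R ^ (-(r * (κ / 2))) * 1 := by
        gcongr
        rw [← h.density.integral_eq_one]
        exact setIntegral_le_integral h.density.integrable
          (Eventually.of_forall h.density.nonneg)
    _ = _ := mul_one _

end Target

/-! ### A polynomially large grid -/

section Grid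

variable {d : ℕ}

/-- The multi-indices of the grid of mesh `n ^ (-3)` covering the ball of radius `2 n ^ p`. -/
noncomputable def gridIndex (d n p : ℕ) : Finset (Fin d → ℤ) :=
  Fintype.piFinset fun _ => Finset.Icc (-(2 * n ^ (p + 3) : ℤ)) (2 * n ^ (p + 3))

/-- The grid point with multi-index `z`. -/
noncomputable def gridPoint (n : ℕ) (z : Fin d → ℤ) : Space d :=
  WithLp.toLp 2 fun i => (z i : ℝ) / (n : ℝ) ^ 3

theorem card_gridIndex_le {n : ℕ} (hn : 3 ≤ n) (p : ℕ) :
    (gridIndex d n p).card ≤ n ^ ((p + 5) * d) := by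
  unfold gridIndex
  rw [Fintype.card_piFinset]
  simp only [Int.card_Icc, Finset.prod_const, Finset.card_univ, Fintype.card_fin]
  rw [pow_mul]
  apply Nat.pow_le_pow_left
  have h1 : 1 ≤ n ^ (p + 3) := Nat.one_le_pow _ _ (by omega)
  have h2 : n ^ (p + 5) = n ^ (p + 3) * n ^ 2 := by rw [← pow_add]
  have h3 : 9 ≤ n ^ 2 := by nlinarith
  have h4 : (2 * (n : ℤ) ^ (p + 3) + 1 - -(2 * (n : ℤ) ^ (p + 3))).toNat = 4 * n ^ (p + 3) + 1 := by
    have : (2 * (n : ℤ) ^ (p + 3) + 1 - -(2 * (n : ℤ) ^ (p + 3)))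
        = ((4 * n ^ (p + 3) + 1 : ℕ) : ℤ) := by push_cast; ring
    rw [this, Int.toNat_natCast]
  rw [h4, h2]
  nlinarith

/-- Rounding each coordinate down moves it by at most one mesh; the resulting `√d` is bounded by
`d`. -/
theorem exists_gridPoint_near {n : ℕ} (hn : 1 ≤ n) (p : ℕ) {x : Space d}
    (hx : ‖x‖ ≤ 2 * (n : ℝ) ^ p) :
    ∃ z ∈ gridIndex d n p, ‖x - gridPoint n z‖ ≤ d / (n : ℝ) ^ 3 := by
  have hn3 : (0 : ℝ) < (n : ℝ) ^ 3 := by positivity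
  refine ⟨fun i => ⌊(n : ℝ) ^ 3 * x i⌋, ?_, ?_⟩
  · rw [gridIndex, Fintype.mem_piFinset]
    intro i
    have h1 : |x i| ≤ 2 * (n : ℝ) ^ p := (PiLp.norm_apply_le x i).trans hx
    obtain ⟨h2, h3⟩ := abs_le.1 h1
    have h4 : (n : ℝ) ^ (p + 3) = (n : ℝ) ^ 3 * (n : ℝ) ^ p := by rw [pow_add]; ring
    rw [Finset.mem_Icc]
    constructor
    · rw [Int.le_floor]
      push_cast
      rw [h4]
      nlinarith
    · have h5 := Int.floor_le ((n : ℝ) ^ 3 * x i)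
      have h6 : ((⌊(n : ℝ) ^ 3 * x i⌋ : ℤ) : ℝ) ≤ 2 * (n : ℝ) ^ (p + 3) := by
        rw [h4]; nlinarith
      exact_mod_cast h6
  · have hcoord : ∀ i, |x i - (⌊(n : ℝ) ^ 3 * x i⌋ : ℝ) / (n : ℝ) ^ 3| ≤ 1 / (n : ℝ) ^ 3 := by
      intro i
      have h5 := Int.floor_le ((n : ℝ) ^ 3 * x i)
      have h6 := Int.lt_floor_add_one ((n : ℝ) ^ 3 * x i)
      have h7 : x i - (⌊(n : ℝ) ^ 3 * x i⌋ : ℝ) / (n : ℝ) ^ 3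
          = ((n : ℝ) ^ 3 * x i - ⌊(n : ℝ) ^ 3 * x i⌋) / (n : ℝ) ^ 3 := by field_simp
      rw [h7, abs_of_nonneg (div_nonneg (by linarith) hn3.le)]
      gcongr
      linarith
    rw [EuclideanSpace.norm_eq]
    refine Real.sqrt_le_iff.2 ⟨by positivity, ?_⟩
    calc ∑ i, ‖(x - gridPoint n fun i => ⌊(n : ℝ) ^ 3 * x i⌋) i‖ ^ 2
        ≤ ∑ _i : Fin d, (1 / (n : ℝ) ^ 3) ^ 2 := by
          refine Finset.sum_le_sum fun i _ => ?_
          gcongr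
          exact hcoord i
      _ = d * (1 / (n : ℝ) ^ 3) ^ 2 := by simp
      _ ≤ (d : ℝ) ^ 2 * (1 / (n : ℝ) ^ 3) ^ 2 := by
          gcongr
          exact_mod_cast Nat.le_self_pow two_ne_zero d
      _ = (d / (n : ℝ) ^ 3) ^ 2 := by ring

end Grid

/-! ### Algebra of self-normalised sums -/

section WeightedSum

variable {Ω : Type*} {d : ℕ} {fU : Space d → ℝ} {X : ℕ → Ω → Space d}
  {q : ℕ → Ω → Space d → ℝ}

theorem weightedSum_mono (hfU0 : ∀ x, 0 ≤ fU x) (hq0 : ∀ k ω x, 0 ≤ q k ω x) (n : ℕ) (ω : Ω)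
    {φ ψ : Space d → ℝ} (h : ∀ y, φ y ≤ ψ y) :
    weightedSum fU X q n ω φ ≤ weightedSum fU X q n ω ψ :=
  Finset.sum_le_sum fun _ _ => mul_le_mul_of_nonneg_left (h _) (div_nonneg (hfU0 _) (hq0 _ _ _))

theorem weightedSum_mul_add_const (n : ℕ) (ω : Ω) (φ : Space d → ℝ) (b c : ℝ) :
    weightedSum fU X q n ω (fun y => b * φ y + c)
      = b * weightedSum fU X q n ω φ + c * weightedSum fU X q n ω (fun _ => 1) := by
  unfold weightedSum
  rw [Finset.mul_sum, Finset.mul_sum, ← Finset.sum_add_distrib]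
  refine Finset.sum_congr rfl fun k _ => ?_
  ring

theorem sum_Icc_eq_weightedSum (n : ℕ) (ω : Ω) (φ : Space d → ℝ) :
    ∑ k ∈ Finset.Icc 1 n, importanceWeight fU X q ω k * φ (X k ω) = weightedSum fU X q n ω φ := by
  induction n with
  | zero => simp [weightedSum]
  | succ n ih =>
    rw [Finset.sum_Icc_succ_top (by omega), ih, weightedSum, weightedSum, Finset.sum_range_succ]
    rfl

theorem kernelEstimate_eq_div {K : Space d → ℝ} {h : ℕ → ℝ} {w : ℕ → Ω → ℕ → ℝ} {n : ℕ} {ω : Ω}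
    (hw : IsNormalizedWeights n (importanceWeight fU X q ω) (w n ω))
    (hpos : 0 < weightedSum fU X q n ω fun _ => 1) (x : Space d) :
    kernelEstimate K h X w n ω x
      = weightedSum fU X q n ω (fun y => scaledKernel K (h n) (x - y))
        / weightedSum fU X q n ω (fun _ => 1) := by
  have h1 := sum_Icc_eq_weightedSum (fU := fU) (X := X) (q := q) n ω fun _ => 1
  simp only [mul_one] at h1
  rw [eq_div_iff hpos.ne', mul_comm,
    ← sum_Icc_eq_weightedSum n ω fun y => scaledKernel K (h n) (x - y), kernelEstimate,
    Finset.mul_sum]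
  refine Finset.sum_congr rfl fun k hk => ?_
  rw [← mul_assoc, ← h1, hw.proportional k hk]

/-- Serves the finitely many small `n`, where all importance weights may vanish and only convexity
is available. -/
theorem IsNormalizedWeights.weighted_mean_mem {n : ℕ} {W v g : ℕ → ℝ} (hv : IsNormalizedWeights n W v)
    {b : ℝ} (hg0 : ∀ k, 0 ≤ g k) (hg : ∀ k, g k ≤ b) :
    0 ≤ ∑ k ∈ Finset.Icc 1 n, v k * g k ∧ ∑ k ∈ Finset.Icc 1 n, v k * g k ≤ b := by
  refine ⟨Finset.sum_nonneg fun k hk => mul_nonneg (hv.nonneg k hk) (hg0 k), ?_⟩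
  calc ∑ k ∈ Finset.Icc 1 n, v k * g k ≤ ∑ k ∈ Finset.Icc 1 n, v k * b :=
        Finset.sum_le_sum fun k hk => mul_le_mul_of_nonneg_left (hg k) (hv.nonneg k hk)
    _ = b := by rw [← Finset.sum_mul, hv.sum_eq_one, one_mul]

end WeightedSum

/-! ### Elementary consequences of the rate -/

section Rate

variable {d : ℕ} {h lam : ℕ → ℝ}

/-- Once `a_n ≤ 1` and `log n ≥ 1`, the identity `n a_n² = log n * h_n^(-d)` bounds `h_n^(-d)` by
`n`. So all kernel constants are polynomial in `n`, and errors of size `1 / n` are negligible. -/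
theorem eventually_rate_facts (hd : 1 ≤ d) (hh_pos : ∀ k, 1 ≤ k → 0 < h k)
    (hh1 : ∀ᶠ n in atTop, h n ≤ 1) (hr : Tendsto (rate d h) atTop (𝓝 0)) :
    ∀ᶠ n in atTop, 3 ≤ n ∧ 0 < h n ∧ h n ≤ 1 ∧ 0 < rate d h n ∧
      n * rate d h n ^ 2 = Real.log n * (h n ^ d)⁻¹ ∧ 1 ≤ (h n ^ d)⁻¹ ∧ (h n ^ d)⁻¹ ≤ n ∧
      (h n)⁻¹ ≤ n ∧ 1 / (n : ℝ) ≤ rate d h n := by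
  filter_upwards [hh1, hr.eventually (eventually_le_nhds one_pos), eventually_ge_atTop 3]
    with n h1 ha hn
  have hn1 : (1 : ℝ) ≤ n := by exact_mod_cast (by omega : 1 ≤ n)
  have hn0 : (0 : ℝ) < n := by linarith
  have hh0 := hh_pos n (by omega)
  have hp : 0 < h n ^ d := pow_pos hh0 d
  have hL : 1 ≤ Real.log n := by
    rw [Real.le_log_iff_exp_le hn0]
    have h3 : (3 : ℝ) ≤ n := by exact_mod_cast hn
    linarith [Real.exp_one_lt_d9]
  have hsq : rate d h n ^ 2 = Real.log n / (n * h n ^ d) :=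
    Real.sq_sqrt (by positivity)
  have ha0 : 0 < rate d h n := Real.sqrt_pos.2 (by positivity)
  have hH : n * rate d h n ^ 2 = Real.log n * (h n ^ d)⁻¹ := by rw [hsq]; field_simp
  have hinv1 : 1 ≤ (h n ^ d)⁻¹ := (one_le_inv₀ hp).2 (pow_le_one₀ hh0.le h1)
  have hinv : (h n ^ d)⁻¹ ≤ n := by
    have h4 : rate d h n ^ 2 ≤ 1 := pow_le_one₀ ha0.le ha
    nlinarith
  have hinv' : (h n)⁻¹ ≤ (h n ^ d)⁻¹ := inv_anti₀ hp (pow_le_of_le_one hh0.le h1 (by omega))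
  refine ⟨hn, hh0, h1, ha0, hH, hinv1, hinv, hinv'.trans hinv, ?_⟩
  refine Real.le_sqrt_of_sq_le ?_
  have h5 : Real.log n / (n * h n ^ d) = Real.log n * (h n ^ d)⁻¹ / n := by field_simp
  rw [h5, le_div_iff₀ hn0]
  calc (1 / (n : ℝ)) ^ 2 * n = 1 / n := by field_simp
    _ ≤ 1 := by rw [div_le_one hn0]; exact hn1
    _ ≤ Real.log n * (h n ^ d)⁻¹ := one_le_mul_of_one_le_of_one_le hL hinv1

end Rate

/-! ### From grid points and tails to all `x` -/

section Deterministic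

variable {Ω : Type*} {d : ℕ} {fU : Space d → ℝ} {X : ℕ → Ω → Space d}
  {q : ℕ → Ω → Space d → ℝ} {n : ℕ} {ω : Ω}

/-- Both functionals are monotone; a shift by `δ` costs `2Uδ` in the empirical mean and `Uδ` in the
integral. -/
theorem weightedSum_deviation_le_of_near (hfU0 : ∀ x, 0 ≤ fU x) (hfU : Integrable fU)
    (hq0 : ∀ k ω x, 0 ≤ q k ω x) {φ ψ : Space d → ℝ} {δ U : ℝ} (hU : ∫ x, fU x = U) (hδ : 0 ≤ δ)
    (hφ : Integrable fun x => fU x * φ x) (hψ : Integrable fun x => fU x * ψ x)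
    (hnear : ∀ y, |φ y - ψ y| ≤ δ)
    (hone : weightedSum fU X q n ω (fun _ => 1) / n ≤ 2 * U) :
    |weightedSum fU X q n ω φ / n - ∫ x, fU x * φ x|
      ≤ |weightedSum fU X q n ω ψ / n - ∫ x, fU x * ψ x| + 3 * U * δ := by
  have hn0 : (0 : ℝ) ≤ n := n.cast_nonneg
  have h1 := weightedSum_mono (X := X) hfU0 hq0 n ω (φ := φ) (ψ := fun y => 1 * ψ y + δ)
    fun y => by linarith [(abs_le.1 (hnear y)).2]
  have h2 := weightedSum_mono (X := X) hfU0 hq0 n ω (φ := ψ) (ψ := fun y => 1 * φ y + δ)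
    fun y => by linarith [(abs_le.1 (hnear y)).1]
  rw [weightedSum_mul_add_const] at h1 h2
  have h3 := div_le_div_of_nonneg_right h1 hn0
  have h4 := div_le_div_of_nonneg_right h2 hn0
  rw [one_mul, add_div, mul_div_assoc] at h3 h4
  have h5 := mul_le_mul_of_nonneg_left hone hδ
  have h6 : ∫ x, fU x * φ x ≤ (∫ x, fU x * ψ x) + δ * U := by
    rw [← hU, ← integral_const_mul, ← integral_add hψ (hfU.const_mul δ)]
    refine integral_mono hφ (hψ.add (hfU.const_mul δ)) fun x => ?_
    have := mul_le_mul_of_nonneg_left (abs_le.1 (hnear x)).2 (hfU0 x)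
    simp only
    linarith
  have h7 : ∫ x, fU x * ψ x ≤ (∫ x, fU x * φ x) + δ * U := by
    rw [← hU, ← integral_const_mul, ← integral_add hφ (hfU.const_mul δ)]
    refine integral_mono hψ (hφ.add (hfU.const_mul δ)) fun x => ?_
    have := mul_le_mul_of_nonneg_left (abs_le.1 (hnear x)).1 (hfU0 x)
    simp only
    linarith
  have h8 := abs_le.1 (le_refl |weightedSum fU X q n ω ψ / n - ∫ x, fU x * ψ x|)
  rw [abs_le]
  constructor <;> linarith [h8.1, h8.2]

/-- No cancellation is used: the empirical mean and the integral are both nonnegative and each is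
small, because the dominating function has a small integral and a small deviation. -/
theorem weightedSum_deviation_le_of_dominated (hfU0 : ∀ x, 0 ≤ fU x) (hfU : Integrable fU)
    (hq0 : ∀ k ω x, 0 ≤ q k ω x) {φ ψ : Space d → ℝ} {b δ U : ℝ} (hU : ∫ x, fU x = U)
    (hδ : 0 ≤ δ) (hb : 0 ≤ b)
    (hφ : Integrable fun x => fU x * φ x) (hψ : Integrable fun x => fU x * ψ x)
    (hφ0 : ∀ y, 0 ≤ φ y) (hle : ∀ y, φ y ≤ b * ψ y + δ)
    (hone : weightedSum fU X q n ω (fun _ => 1) / n ≤ 2 * U) :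
    |weightedSum fU X q n ω φ / n - ∫ x, fU x * φ x|
      ≤ b * |weightedSum fU X q n ω ψ / n - ∫ x, fU x * ψ x|
        + b * (∫ x, fU x * ψ x) + 2 * U * δ := by
  have hn0 : (0 : ℝ) ≤ n := n.cast_nonneg
  have h1 := weightedSum_mono (X := X) hfU0 hq0 n ω hle
  rw [weightedSum_mul_add_const] at h1
  have h3 := div_le_div_of_nonneg_right h1 hn0
  rw [add_div, mul_div_assoc, mul_div_assoc] at h3
  have h5 := mul_le_mul_of_nonneg_left hone hδ
  have h6 : ∫ x, fU x * φ x ≤ b * (∫ x, fU x * ψ x) + δ * U := by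
    rw [← hU, ← integral_const_mul, ← integral_const_mul,
      ← integral_add (hψ.const_mul b) (hfU.const_mul δ)]
    refine integral_mono hφ ((hψ.const_mul b).add (hfU.const_mul δ)) fun x => ?_
    have := mul_le_mul_of_nonneg_left (hle x) (hfU0 x)
    simp only
    linarith
  have h7 : 0 ≤ ∫ x, fU x * φ x := integral_nonneg fun x => mul_nonneg (hfU0 x) (hφ0 x)
  have h8 : 0 ≤ weightedSum fU X q n ω φ / n := by
    refine div_nonneg (Finset.sum_nonneg fun k _ => ?_) hn0
    exact mul_nonneg (div_nonneg (hfU0 _) (hq0 _ _ _)) (hφ0 _)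
  have h9 := mul_le_mul_of_nonneg_left
    (le_abs_self (weightedSum fU X q n ω ψ / n - ∫ x, fU x * ψ x)) hb
  have hU0 : 0 ≤ U := hU ▸ integral_nonneg hfU0
  have h10 : 0 ≤ δ * U := mul_nonneg hδ hU0
  have h11 := mul_nonneg hb
    (abs_nonneg (weightedSum fU X q n ω ψ / n - ∫ x, fU x * ψ x))
  rw [abs_le]
  constructor <;> linarith

/-- The deviation of a ratio of sums from the ratio of their limits. -/
theorem abs_div_sub_le {N D U F η A₁ A₂ M : ℝ} (hU : 0 < U) (hD : U / 2 ≤ D)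
    (hN : |N - U * F| ≤ A₂ * η) (hDU : |D - U| ≤ A₁ * η) (hF0 : 0 ≤ F) (hFM : F ≤ M) :
    |N / D - F| ≤ 2 / U * (A₂ + M * A₁) * η := by
  have hD0 : 0 < D := by linarith
  have h1 : N / D - F = ((N - U * F) - F * (D - U)) / D := by field_simp; ring
  rw [h1, abs_div, abs_of_pos hD0, div_le_iff₀ hD0]
  have h2 : |(N - U * F) - F * (D - U)| ≤ A₂ * η + M * (A₁ * η) := by
    refine (abs_sub _ _).trans (add_le_add hN ?_)
    rw [abs_mul, abs_of_nonneg hF0]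
    exact mul_le_mul hFM hDU (abs_nonneg _) (hF0.trans hFM)
  have h3 : 0 ≤ A₂ * η + M * (A₁ * η) := (abs_nonneg _).trans h2
  calc _ ≤ A₂ * η + M * (A₁ * η) := h2
    _ = 2 / U * (A₂ * η + M * (A₁ * η)) * (U / 2) := by field_simp
    _ ≤ 2 / U * (A₂ * η + M * (A₁ * η)) * D := by gcongr
    _ = _ := by ring

/-- The rescaled indicator of the complement of the ball of radius `n ^ p`. -/
noncomputable def tailFunction (d : ℕ) (H : ℝ) (n p : ℕ) : Space d → ℝ :=
  Set.indicator {y | (n : ℝ) ^ p < ‖y‖} fun _ => H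

theorem measurableSet_tail (d n p : ℕ) : MeasurableSet {y : Space d | (n : ℝ) ^ p < ‖y‖} :=
  measurableSet_lt measurable_const measurable_norm

theorem measurable_tailFunction (d : ℕ) (H : ℝ) (n p : ℕ) : Measurable (tailFunction d H n p) :=
  measurable_const.indicator (measurableSet_tail d n p)

theorem tailFunction_nonneg {d : ℕ} {H : ℝ} (hH : 0 ≤ H) (n p : ℕ) (y : Space d) :
    0 ≤ tailFunction d H n p y :=
  Set.indicator_nonneg (fun _ _ => hH) y

theorem tailFunction_le {d : ℕ} {H : ℝ} (hH : 0 ≤ H) (n p : ℕ) (y : Space d) :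
    tailFunction d H n p y ≤ H :=
  Set.indicator_le_self' (f := fun _ : Space d => H) (fun _ _ => hH) y

theorem integral_mul_tailFunction (g : Space d → ℝ) (H : ℝ) (n p : ℕ) :
    ∫ x, g x * tailFunction d H n p x = H * ∫ x in {y | (n : ℝ) ^ p < ‖y‖}, g x := by
  rw [← integral_const_mul, ← integral_indicator (measurableSet_tail d n p)]
  refine integral_congr_ae (Eventually.of_forall fun x => ?_)
  simp only [tailFunction, Set.indicator]
  split_ifs <;> ring

theorem tailFunction_sq (H : ℝ) (n p : ℕ) (x : Space d) :
    tailFunction d H n p x ^ 2 = tailFunction d (H ^ 2) n p x := by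
  simp only [tailFunction, Set.indicator]
  split_ifs <;> ring

/-- Uniform deviation of the kernel sums, from that of the grid points and of the tail. -/
theorem kernel_deviation_le {K : Space d → ℝ} (hK : AdmissibleKernel K) (hfU0 : ∀ x, 0 ≤ fU x)
    (hfU : Integrable fU) (hq0 : ∀ k ω x, 0 ≤ q k ω x) {U h η A₂ A₃ C₂ CK Ct r L : ℝ} {p : ℕ}
    (hU : ∫ x, fU x = U) (hn : 1 ≤ n) (hh : 0 < h) (hh1 : h ≤ 1) (hH : (h ^ d)⁻¹ ≤ n)
    (hhn : h⁻¹ ≤ n) (hη : 1 / (n : ℝ) ≤ η) (hCK : 0 ≤ CK) (hKb : ∀ u, K u ≤ CK) (hCt : 0 ≤ Ct)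
    (hKt : ∀ h : ℝ, 0 < h → h ≤ 1 → ∀ R : ℝ, 0 < R → ∀ u : Space d, R ≤ ‖u‖ →
      scaledKernel K h u ≤ Ct * R ^ (-r) * (h ^ d)⁻¹)
    (hR : ((n : ℝ) ^ p) ^ (-r) ≤ 1 / (n : ℝ) ^ 2) (hL : 0 ≤ L)
    (hKL : ∀ h : ℝ, 0 < h → ∀ u v : Space d,
      |scaledKernel K h u - scaledKernel K h v| ≤ L * (h⁻¹ * (h ^ d)⁻¹) * ‖u - v‖)
    (hone : weightedSum fU X q n ω (fun _ => 1) / n ≤ 2 * U)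
    (htail : |weightedSum fU X q n ω (tailFunction d (h ^ d)⁻¹ n p) / n
      - ∫ x, fU x * tailFunction d (h ^ d)⁻¹ n p x| ≤ A₂ * η)
    (hmtail : ∫ x, fU x * tailFunction d (h ^ d)⁻¹ n p x ≤ C₂ * η)
    (hgrid : ∀ z ∈ gridIndex d n p,
      |weightedSum fU X q n ω (fun y => scaledKernel K h (gridPoint n z - y)) / n
      - ∫ y, fU y * scaledKernel K h (gridPoint n z - y)| ≤ A₃ * η) (x : Space d) :
    |weightedSum fU X q n ω (fun y => scaledKernel K h (x - y)) / n
      - ∫ y, fU y * scaledKernel K h (x - y)|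
      ≤ (|A₃| + 3 * U * (L * d) + CK * (|A₂| + |C₂|) + 2 * U * Ct) * η := by
  have hn0 : (0 : ℝ) < n := by positivity
  have hη0 : 0 < η := lt_of_lt_of_le (by positivity) hη
  have hp : 0 < h ^ d := pow_pos hh d
  have hU0 : 0 ≤ U := hU ▸ integral_nonneg hfU0
  have hKx : ∀ x y, scaledKernel K h (x - y) ≤ CK * (h ^ d)⁻¹ := fun x y => by
    rw [scaledKernel, div_eq_mul_inv]
    exact mul_le_mul_of_nonneg_right (hKb _) (by positivity)
  have hint : ∀ x, Integrable fun y => fU y * scaledKernel K h (x - y) := fun x =>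
    hfU.mul_bdd (c := CK * (h ^ d)⁻¹) (hK.measurable_scaledKernel h x).aestronglyMeasurable
      (Eventually.of_forall fun y => by
        rw [Real.norm_eq_abs, abs_of_nonneg (hK.scaledKernel_nonneg hh _)]; exact hKx x y)
  have hUL : 0 ≤ 3 * U * (L * d) := by positivity
  have hUCt : 0 ≤ 2 * U * Ct := by positivity
  have hCK' : 0 ≤ CK * (|A₂| + |C₂|) := by positivity
  -- For moderate `x` the kernel has Lipschitz constant at most `L * n²`, against a mesh `n^(-3)`.
  -- For larger `x`, a particle in the ball of radius `n^p` lies at distance at least `n^p` from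
  -- `x`, so only particles outside that ball matter, up to `Ct / n`.
  rcases le_or_gt ‖x‖ (2 * (n : ℝ) ^ p) with hx | hx
  · obtain ⟨z, hz, hxz⟩ := exists_gridPoint_near hn p hx
    have hnear : ∀ y, |scaledKernel K h (x - y) - scaledKernel K h (gridPoint n z - y)|
        ≤ L * d * (1 / n) := by
      intro y
      refine (hKL h hh _ _).trans ?_
      rw [sub_sub_sub_cancel_right]
      calc L * (h⁻¹ * (h ^ d)⁻¹) * ‖x - gridPoint n z‖
          ≤ L * (n * n) * (d / (n : ℝ) ^ 3) := by gcongr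
        _ = L * d * (1 / n) := by field_simp
    refine (weightedSum_deviation_le_of_near hfU0 hfU hq0 hU (by positivity) (hint x) (hint _)
      hnear hone).trans ?_
    have h1 := hgrid z hz
    have h2 : 3 * U * (L * d * (1 / n)) ≤ 3 * U * (L * d) * η := by
      rw [← mul_assoc]; gcongr
    have h3 : A₃ * η ≤ |A₃| * η := by gcongr; exact le_abs_self _
    nlinarith
  · have htailint : Integrable fun y => fU y * tailFunction d (h ^ d)⁻¹ n p y :=
      hfU.mul_bdd (c := (h ^ d)⁻¹) (measurable_tailFunction d _ n p).aestronglyMeasurable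
        (Eventually.of_forall fun y => by
          rw [Real.norm_eq_abs, abs_of_nonneg (tailFunction_nonneg (by positivity) n p y)]
          exact tailFunction_le (by positivity) n p y)
    have hle : ∀ y, scaledKernel K h (x - y)
        ≤ CK * tailFunction d (h ^ d)⁻¹ n p y + Ct * (1 / n) := by
      intro y
      by_cases hy : (n : ℝ) ^ p < ‖y‖
      · have : tailFunction d (h ^ d)⁻¹ n p y = (h ^ d)⁻¹ :=
          Set.indicator_of_mem (s := {y : Space d | (n : ℝ) ^ p < ‖y‖}) hy _
        rw [this]
        have h5 : 0 ≤ Ct * (1 / (n : ℝ)) := by positivity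
        linarith [hKx x y]
      · have h6 : tailFunction d (h ^ d)⁻¹ n p y = 0 :=
          Set.indicator_of_notMem (s := {y : Space d | (n : ℝ) ^ p < ‖y‖}) hy _
        have h7 : (n : ℝ) ^ p ≤ ‖x - y‖ := by
          have := norm_sub_norm_le x y
          linarith [not_lt.1 hy]
        rw [h6, mul_zero, zero_add]
        calc scaledKernel K h (x - y) ≤ Ct * ((n : ℝ) ^ p) ^ (-r) * (h ^ d)⁻¹ :=
              hKt h hh hh1 _ (by positivity) _ h7
          _ ≤ Ct * (1 / (n : ℝ) ^ 2) * n := by gcongr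
          _ = Ct * (1 / n) := by field_simp
    refine (weightedSum_deviation_le_of_dominated hfU0 hfU hq0 hU (by positivity) hCK (hint x)
      htailint (fun y => hK.scaledKernel_nonneg hh _) hle hone).trans ?_
    have h1 : CK * |weightedSum fU X q n ω (tailFunction d (h ^ d)⁻¹ n p) / n
      - ∫ x, fU x * tailFunction d (h ^ d)⁻¹ n p x| ≤ CK * (|A₂| * η) := by
      gcongr
      exact htail.trans (by gcongr; exact le_abs_self _)
    have h2 : CK * (∫ x, fU x * tailFunction d (h ^ d)⁻¹ n p x) ≤ CK * (|C₂| * η) := by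
      gcongr
      exact hmtail.trans (by gcongr; exact le_abs_self _)
    have h3 : 2 * U * (Ct * (1 / n)) ≤ 2 * U * Ct * η := by
      rw [← mul_assoc]; gcongr
    nlinarith [abs_nonneg A₃]

end Deterministic

theorem pow_rpow_neg_le {n p : ℕ} (hn : 1 ≤ n) {s : ℝ} (hs : 2 ≤ p * s) :
    ((n : ℝ) ^ p) ^ (-s) ≤ 1 / (n : ℝ) ^ 2 := by
  have hn0 : (0 : ℝ) ≤ n := n.cast_nonneg
  have hn1 : (1 : ℝ) ≤ n := by exact_mod_cast hn
  rw [← Real.rpow_natCast, ← Real.rpow_mul hn0, one_div, ← Real.rpow_natCast, ← Real.rpow_neg hn0]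
  apply Real.rpow_le_rpow_of_exponent_le hn1
  push_cast
  linarith

/-- A single radius `n^p` has to serve three decays: the tail of `f^κ` (variance), the tail of `f`
(mean) and the kernel. -/
theorem exists_pow_rpow_neg_le {s₁ s₂ s₃ : ℝ} (h₁ : 0 < s₁) (h₂ : 0 < s₂) (h₃ : 0 < s₃) :
    ∃ p : ℕ, ∀ n : ℕ, 1 ≤ n → ((n : ℝ) ^ p) ^ (-s₁) ≤ 1 / (n : ℝ) ^ 2 ∧
      ((n : ℝ) ^ p) ^ (-s₂) ≤ 1 / (n : ℝ) ^ 2 ∧ ((n : ℝ) ^ p) ^ (-s₃) ≤ 1 / (n : ℝ) ^ 2 := by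
  obtain ⟨p, hp⟩ := exists_nat_ge (2 / s₁ + 2 / s₂ + 2 / s₃)
  have e₁ : 0 < 2 / s₁ := by positivity
  have e₂ : 0 < 2 / s₂ := by positivity
  have e₃ : 0 < 2 / s₃ := by positivity
  exact ⟨p, fun n hn => ⟨pow_rpow_neg_le hn ((div_le_iff₀ h₁).1 (by linarith)),
    pow_rpow_neg_le hn ((div_le_iff₀ h₂).1 (by linarith)),
    pow_rpow_neg_le hn ((div_le_iff₀ h₃).1 (by linarith))⟩⟩

/-! ### Uniform convergence given control of the squared weights -/

section Convergence

variable {Ω : Type*} [MeasurableSpace Ω] {P : Measure Ω} {d : ℕ} {fU q0 K : Space d → ℝ}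
  {h lam : ℕ → ℝ} {X : ℕ → Ω → Space d} {q : ℕ → Ω → Space d → ℝ} {w : ℕ → Ω → ℕ → ℝ}

theorem IsStandardSAIS.kernelEstimate_nonneg (hs : IsStandardSAIS P fU q0 K h lam X q w)
    (hK : AdmissibleKernel K) (hh_pos : ∀ k, 1 ≤ k → 0 < h k) {k : ℕ} (hk : 1 ≤ k) (ω : Ω)
    (x : Space d) : 0 ≤ kernelEstimate K h X w k ω x :=
  Finset.sum_nonneg fun j hj => mul_nonneg ((hs.weights ω k hk).nonneg j hj)
    (hK.scaledKernel_nonneg (hh_pos k hk) _)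

/-- The policy dominates its safe component. -/
theorem IsStandardSAIS.mul_safe_le (hs : IsStandardSAIS P fU q0 K h lam X q w)
    (hK : AdmissibleKernel K) (hq0 : ∀ x, 0 ≤ q0 x) (hh_pos : ∀ k, 1 ≤ k → 0 < h k)
    (hlam_le : ∀ k, 1 ≤ k → lam k ≤ 1)
    (hlam_anti : ∀ j k, 1 ≤ j → j ≤ k → lam k ≤ lam j) {k n : ℕ} (hkn : k < n) (ω : Ω)
    (x : Space d) : lam n * q0 x ≤ q k ω x := by
  rcases Nat.eq_zero_or_pos k with rfl | hk
  · rw [hs.init]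
    exact mul_le_of_le_one_left (hq0 x) (hlam_le n hkn)
  · rw [hs.update k hk]
    have h1 := hs.kernelEstimate_nonneg hK hh_pos hk ω x
    have h2 := mul_le_mul_of_nonneg_right (hlam_anti k n hk hkn.le) (hq0 x)
    have h3 := mul_nonneg (sub_nonneg.2 (hlam_le k hk)) h1
    linarith

set_option maxHeartbeats 1000000 in
/-- If the squared weights are controlled at the scale `v`, the kernel estimate converges
uniformly at the rate `a_n √v_n + h_n ^ 2`. -/
theorem IsStandardSAIS.eventually_abs_kernelEstimate_sub_le [IsProbabilityMeasure P]
    (hs : IsStandardSAIS P fU q0 K h lam X q w) (hd : 1 ≤ d)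
    (hfU_meas : Measurable fU) (hfU_nonneg : ∀ x, 0 ≤ fU x)
    (hfU_int : Integrable fU) (hfU_pos : 0 < ∫ x, fU x)
    (H1 : SmoothTarget (target fU)) (H2 : SafeDensity (target fU) q0) (H3 : AdmissibleKernel K)
    (hh_pos : ∀ k, 1 ≤ k → 0 < h k) (hlam_pos : ∀ k, 1 ≤ k → 0 < lam k)
    (hlam_le : ∀ k, 1 ≤ k → lam k ≤ 1)
    (hlam_anti : ∀ j k, 1 ≤ j → j ≤ k → lam k ≤ lam j)
    (hh1 : ∀ᶠ n in atTop, h n ≤ 1) (hr : Tendsto (rate d h) atTop (𝓝 0))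
    (hrl : Tendsto (fun n => rate d h n / lam n) atTop (𝓝 0))
    {v : ℕ → ℝ} (hv1 : ∀ n, 1 ≤ n → 1 ≤ v n) (hvl : ∀ n, 1 ≤ n → v n ≤ 1 / lam n)
    {κ : ℝ} (hκ : 0 < κ) (hκ1 : κ ≤ 1) :
    ∀ᵐ ω ∂P, (∃ B : ℝ, ∀ n, 1 ≤ n → ∀ k < n, ∀ x,
        fU x ^ 2 ≤ B * v n * target fU x ^ κ * q k ω x) →
      ∃ C : ℝ, ∀ᶠ n in atTop, ∀ x, |kernelEstimate K h X w n ω x - target fU x|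
        ≤ C * (rate d h n * √(v n) + h n ^ 2) := by
  set U := ∫ x, fU x with hU
  set f := target fU with hf
  have hff : ∀ x, fU x = U * f x := fun x => by
    rw [hf, target, ← hU]; field_simp
  have hq0 : ∀ k ω x, 0 ≤ q k ω x := fun k ω x => (hs.policy.density k ω).nonneg x
  have hf0 : ∀ x, 0 ≤ f x := H1.density.nonneg
  obtain ⟨M, hM0, hM⟩ := H2.exists_target_bound
  obtain ⟨c, hc0, hc⟩ := H2.exists_le_mul
  obtain ⟨CK, hCK0, hCK⟩ := H3.exists_bound
  obtain ⟨Ct, r, hCt, hr0, hKt⟩ := H3.exists_tail_bound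
  obtain ⟨L, hL0, hKL⟩ := H3.exists_lipschitz_bound
  obtain ⟨Cb, hCb0, hbias⟩ := exists_bias_bound H1 H3
  obtain ⟨T₁, s₁, hT₁, hs₁, htail₁⟩ := H2.exists_tail_integral_bound H1.density hκ hκ1
  obtain ⟨T₂, s₂, hT₂, hs₂, htail₂⟩ := H2.exists_tail_integral_bound H1.density one_pos le_rfl
  simp only [Real.rpow_one] at htail₂
  obtain ⟨p, hp⟩ := exists_pow_rpow_neg_le hs₁ hs₂ hr0
  set G : Space d → ℝ := fun x => f x ^ κ with hGdef
  have hG0 : ∀ x, 0 ≤ G x := fun x => Real.rpow_nonneg (hf0 x) κ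
  have hG : Integrable G := H2.integrable_rpow H1.density hκ hκ1
  have hI : 0 ≤ ∫ x, G x := integral_nonneg fun x => hG0 x
  have hGM : ∀ x, G x ≤ M ^ κ := fun x => Real.rpow_le_rpow (hf0 x) (hM x) hκ.le
  have hfacts := eventually_rate_facts hd hh_pos hh1 hr
  have hscale : ∀ᶠ n in atTop, 0 < rate d h n ∧ 0 < (h n ^ d)⁻¹ ∧
      n * rate d h n ^ 2 = Real.log n * (h n ^ d)⁻¹ ∧ 1 ≤ v n ∧ 0 < lam n ∧ lam n ≤ 1 := by
    filter_upwards [hfacts] with n ⟨hn, hh0, _, ha, hsc, hH, _⟩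
    exact ⟨ha, by positivity, hsc, hv1 n (by omega), hlam_pos n (by omega), hlam_le n (by omega)⟩
  have hw : ∀ᶠ n in atTop, ∀ k < n, ∀ ω x, fU x / q k ω x ≤ U * c / lam n := by
    filter_upwards [eventually_ge_atTop 1] with n hn k hk ω x
    have hl := hlam_pos n hn
    refine div_le_of_le_mul₀ (hq0 k ω x) (by positivity) ?_
    have h1 := hs.mul_safe_le H3 H2.density.nonneg hh_pos hlam_le hlam_anti hk ω x
    calc fU x ≤ U * (c * q0 x) := by rw [hff]; gcongr; exact hc x
      _ = U * c / lam n * (lam n * q0 x) := by field_simp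
      _ ≤ U * c / lam n * q k ω x := by gcongr
  have hUc : 0 ≤ U * c := by positivity
  -- The constant function handles the normalising denominator. All three deviation bounds are taken
  -- for every integer `B`, since the constant in the squared-weight bound may be random and
  -- countably many null sets can be discarded.
  have hdev1 := fun B : ℕ => hs.policy.eventually_deviation_le hfU_meas hfU_nonneg hfU_int hG0 hG
    (I := fun _ => {()}) (φ := fun _ _ _ => 1) (C := 1 + ∫ x, G x) (γ := 0)
    (by positivity) hUc
    (Eventually.of_forall fun n => by simp) hscale hrl
    (by
      filter_upwards [hfacts] with n ⟨hn, hh0, _, ha, hsc, hH, _⟩ i _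
      refine ⟨measurable_const, fun _ => zero_le_one, fun _ => ?_, ?_⟩
      · nlinarith
      · simp only [one_pow, mul_one]
        nlinarith) hw B
  have hdev2 := fun B : ℕ => hs.policy.eventually_deviation_le hfU_meas hfU_nonneg hfU_int hG0 hG
    (I := fun _ => {()}) (φ := fun n _ => tailFunction d (h n ^ d)⁻¹ n p) (C := 1 + T₁) (γ := 0)
    (by positivity) hUc (Eventually.of_forall fun n => by simp) hscale hrl
    (by
      filter_upwards [hfacts] with n ⟨hn, hh0, _, ha, hsc, hH, hHn, _⟩ i _
      have hH0 : 0 ≤ (h n ^ d)⁻¹ := by positivity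
      have hn0 : (0 : ℝ) < n := by positivity
      refine ⟨measurable_tailFunction d _ n p, tailFunction_nonneg hH0 n p, fun y => ?_, ?_⟩
      · exact (tailFunction_le hH0 n p y).trans (by nlinarith)
      · simp only [tailFunction_sq]
        rw [integral_mul_tailFunction]
        -- The indicator has height `H`, so its square has one factor `H ≤ n` too many; the tail
        -- integral, of order `n^(-2)`, absorbs it.
        calc ((h n ^ d)⁻¹) ^ 2 * ∫ x in {y | (n : ℝ) ^ p < ‖y‖}, G x
            ≤ ((h n ^ d)⁻¹) ^ 2 * (T₁ * (1 / (n : ℝ) ^ 2)) := by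
              gcongr
              exact (htail₁ _ (by positivity)).trans
                (mul_le_mul_of_nonneg_left (hp n (by omega)).1 hT₁.le)
          _ = (h n ^ d)⁻¹ * T₁ * ((h n ^ d)⁻¹ / (n : ℝ) ^ 2) := by ring
          _ ≤ (h n ^ d)⁻¹ * T₁ * 1 := by
              gcongr
              rw [div_le_one (by positivity)]
              have : (1 : ℝ) ≤ n := by exact_mod_cast (by omega : 1 ≤ n)
              nlinarith
          _ ≤ (1 + T₁) * (h n ^ d)⁻¹ := by linarith) hw B
  have hdev3 := fun B : ℕ => hs.policy.eventually_deviation_le hfU_meas hfU_nonneg hfU_int hG0 hG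
    (I := fun n => gridIndex d n p)
    (φ := fun n z y => scaledKernel K (h n) (gridPoint n z - y)) (C := CK + CK * M ^ κ)
    (γ := (p + 5) * d) (by positivity) hUc
    (by filter_upwards [eventually_ge_atTop 3] with n hn using card_gridIndex_le hn p) hscale hrl
    (by
      filter_upwards [hfacts] with n ⟨hn, hh0, _, ha, hsc, hH, hHn, _⟩ z _
      have hH0 : 0 ≤ (h n ^ d)⁻¹ := by positivity
      have hKx : ∀ y, scaledKernel K (h n) (gridPoint n z - y) ≤ CK * (h n ^ d)⁻¹ := fun y => by
        rw [scaledKernel, div_eq_mul_inv]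
        exact mul_le_mul_of_nonneg_right (hCK _) hH0
      have hK0 : ∀ y, 0 ≤ scaledKernel K (h n) (gridPoint n z - y) := fun y =>
        H3.scaledKernel_nonneg hh0 _
      have hMκ : 0 ≤ M ^ κ := by positivity
      refine ⟨H3.measurable_scaledKernel _ _, hK0, fun y => (hKx y).trans ?_, ?_⟩
      · gcongr
        have : 0 ≤ CK * M ^ κ := by positivity
        linarith
      -- One kernel factor is bounded by `CK * H`; the other integrates to one.
      · calc ∫ x, G x * scaledKernel K (h n) (gridPoint n z - x) ^ 2
            ≤ ∫ x, M ^ κ * (CK * (h n ^ d)⁻¹) * scaledKernel K (h n) (gridPoint n z - x) := by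
              refine integral_mono_of_nonneg
                (Eventually.of_forall fun x => mul_nonneg (hG0 x) (sq_nonneg _))
                ((H3.integrable_scaledKernel hh0 _).const_mul _)
                (Eventually.of_forall fun x => ?_)
              simp only
              rw [pow_two, ← mul_assoc]
              exact mul_le_mul_of_nonneg_right (mul_le_mul (hGM x) (hKx x) (hK0 x) hMκ) (hK0 x)
          _ = CK * M ^ κ * (h n ^ d)⁻¹ := by
              rw [integral_const_mul, H3.integral_scaledKernel hh0]; ring
          _ ≤ (CK + CK * M ^ κ) * (h n ^ d)⁻¹ := by
              gcongr; linarith) hw B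
  choose A₁ hA₁ hd1 using hdev1
  choose A₂ hA₂ hd2 using hdev2
  choose A₃ hA₃ hd3 using hdev3
  -- Since `v ≥ 1`, `√v ≤ v ≤ 1 / λ_n`. The limit keeps the denominator above `U / 2`.
  have hηlim : Tendsto (fun n => rate d h n * √(v n)) atTop (𝓝 0) := by
    refine tendsto_of_tendsto_of_tendsto_of_le_of_le' tendsto_const_nhds hrl ?_ ?_
    · exact Eventually.of_forall fun n => mul_nonneg (Real.sqrt_nonneg _) (Real.sqrt_nonneg _)
    · filter_upwards [eventually_ge_atTop 1] with n hn
      have h1 : √(v n) ≤ v n := by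
        rw [Real.sqrt_le_left (by linarith [hv1 n hn])]
        nlinarith [hv1 n hn]
      rw [div_eq_mul_one_div]
      exact mul_le_mul_of_nonneg_left (h1.trans (hvl n hn)) (Real.sqrt_nonneg _)
  filter_upwards [ae_all_iff.2 hd1, ae_all_iff.2 hd2, ae_all_iff.2 hd3] with ω e1 e2 e3 hB
  obtain ⟨B, hB⟩ := hB
  obtain ⟨B', hB'⟩ := exists_nat_ge B
  set A₄ := |A₃ B'| + 3 * U * (L * d) + CK * (|A₂ B'| + |U * T₂|) + 2 * U * Ct with hA₄
  have hA₄0 : 0 ≤ A₄ := by positivity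
  refine ⟨2 / U * (A₄ + M * A₁ B') + Cb, ?_⟩
  have hsmall : ∀ᶠ n in atTop, A₁ B' * (rate d h n * √(v n)) ≤ U / 2 := by
    have := hηlim.const_mul (A₁ B')
    rw [mul_zero] at this
    exact this.eventually (eventually_le_nhds (by linarith))
  filter_upwards [e1 B', e2 B', e3 B', hfacts, hsmall] with n g1 g2 g3
    ⟨hn, hh0, hh1, ha, hsc, hH, hHn, hhn, han⟩ hsm x
  have hn1 : 1 ≤ n := by omega
  have hcond : ∀ k < n, ∀ x, fU x ^ 2 ≤ B' * v n * G x * q k ω x := fun k hk x => by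
    refine (hB n hn1 k hk x).trans ?_
    have hvn := hv1 n hn1
    have := hG0 x
    have := hq0 k ω x
    gcongr
  have g1 := g1 hcond () (Finset.mem_singleton_self _)
  have g2 := g2 hcond () (Finset.mem_singleton_self _)
  have g3 := g3 hcond
  set η := rate d h n * √(v n) with hη
  have hη1 : 1 / (n : ℝ) ≤ η := by
    have : 1 ≤ √(v n) := by rw [Real.one_le_sqrt]; exact hv1 n hn1
    nlinarith
  have hη0 : 0 < η := lt_of_lt_of_le (by positivity) hη1
  simp only [mul_one] at g1
  rw [← hU] at g1
  have g1' := abs_le.1 g1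
  have hone : weightedSum fU X q n ω (fun _ => 1) / n ≤ 2 * U := by linarith [g1'.2]
  have hone' : U / 2 ≤ weightedSum fU X q n ω (fun _ => 1) / n := by linarith [g1'.1]
  have hH0 : 0 ≤ (h n ^ d)⁻¹ := by linarith
  have hn0 : (0 : ℝ) < n := by positivity
  have hmtail : ∫ x, fU x * tailFunction d (h n ^ d)⁻¹ n p x ≤ U * T₂ * η := by
    rw [integral_mul_tailFunction]
    simp only [hff]
    rw [integral_const_mul]
    calc (h n ^ d)⁻¹ * (U * ∫ x in {y | (n : ℝ) ^ p < ‖y‖}, f x)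
        ≤ n * (U * (T₂ * (1 / (n : ℝ) ^ 2))) := by
          have hint0 : 0 ≤ ∫ x in {y | (n : ℝ) ^ p < ‖y‖}, f x := integral_nonneg hf0
          gcongr
          exact (htail₂ _ (by positivity)).trans
            (mul_le_mul_of_nonneg_left (hp n hn1).2.1 hT₂.le)
      _ = U * T₂ * (1 / n) := by field_simp
      _ ≤ U * T₂ * η := by gcongr
  have hkd := kernel_deviation_le H3 hfU_nonneg hfU_int hq0 hU.symm hn1 hh0 hh1 hHn hhn hη1
    hCK0.le hCK hCt.le hKt (hp n hn1).2.2 hL0 hKL hone g2 hmtail g3 x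
  have hmF : ∫ y, fU y * scaledKernel K (h n) (x - y)
      = U * ∫ y, f y * scaledKernel K (h n) (x - y) := by
    rw [← integral_const_mul]
    refine integral_congr_ae (Eventually.of_forall fun y => ?_)
    simp only [hff y]; ring
  set F := ∫ y, f y * scaledKernel K (h n) (x - y) with hF
  have hF0 : 0 ≤ F := integral_nonneg fun y => mul_nonneg (hf0 y) (H3.scaledKernel_nonneg hh0 _)
  have hFM : F ≤ M := by
    calc F ≤ ∫ y, M * scaledKernel K (h n) (x - y) := by
          refine integral_mono_of_nonneg (Eventually.of_forall fun y =>
            mul_nonneg (hf0 y) (H3.scaledKernel_nonneg hh0 _))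
            ((H3.integrable_scaledKernel hh0 x).const_mul M) (Eventually.of_forall fun y => ?_)
          exact mul_le_mul_of_nonneg_right (hM y) (H3.scaledKernel_nonneg hh0 _)
      _ = M := by rw [integral_const_mul, H3.integral_scaledKernel hh0, mul_one]
  rw [hmF] at hkd
  have hratio := abs_div_sub_le hfU_pos hone' hkd g1 hF0 hFM
  have hpos : 0 < weightedSum fU X q n ω (fun _ => 1) := by
    have : 0 < weightedSum fU X q n ω (fun _ => 1) / n := by linarith
    by_contra hcon
    exact absurd this (not_lt.2 (div_nonpos_of_nonpos_of_nonneg (not_lt.1 hcon) hn0.le))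
  rw [div_div_div_cancel_right₀ hn0.ne', ← kernelEstimate_eq_div (hs.weights ω n hn1) hpos] at hratio
  have hb := hbias (h n) hh0 x
  calc |kernelEstimate K h X w n ω x - f x|
      ≤ |kernelEstimate K h X w n ω x - F| + |F - f x| := abs_sub_le _ _ _
    _ ≤ 2 / U * (A₄ + M * A₁ B') * η + Cb * h n ^ 2 := add_le_add hratio hb
    _ ≤ (2 / U * (A₄ + M * A₁ B') + Cb) * (η + h n ^ 2) := by
        have h1 : 0 ≤ 2 / U * (A₄ + M * A₁ B') * h n ^ 2 := by
          have := hA₁ B'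
          positivity
        have h2 : 0 ≤ Cb * η := by positivity
        linarith

end Convergence

/-! ### The two stages of the bootstrap -/

section Stages

variable {Ω : Type*} [MeasurableSpace Ω] {P : Measure Ω} {d : ℕ} {fU q0 K : Space d → ℝ}
  {h lam : ℕ → ℝ} {X : ℕ → Ω → Space d} {q : ℕ → Ω → Space d → ℝ} {w : ℕ → Ω → ℕ → ℝ}

/-- Control of the squared weights by the safe component of the policy. -/
theorem IsStandardSAIS.exists_sq_le_div (hs : IsStandardSAIS P fU q0 K h lam X q w)
    (hfU_pos : 0 < ∫ x, fU x) (H1 : SmoothTarget (target fU)) (H2 : SafeDensity (target fU) q0)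
    (H3 : AdmissibleKernel K) (hh_pos : ∀ k, 1 ≤ k → 0 < h k) (hlam_pos : ∀ k, 1 ≤ k → 0 < lam k)
    (hlam_le : ∀ k, 1 ≤ k → lam k ≤ 1)
    (hlam_anti : ∀ j k, 1 ≤ j → j ≤ k → lam k ≤ lam j) {κ : ℝ} (hκ : 0 < κ) (hκ1 : κ ≤ 1) :
    ∃ B : ℝ, 0 ≤ B ∧ ∀ n, ∀ k < n, ∀ ω x,
      fU x ^ 2 ≤ B * (1 / lam n) * target fU x ^ κ * q k ω x := by
  set U := ∫ x, fU x with hU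
  set f := target fU with hf
  have hff : ∀ x, fU x = U * f x := fun x => by
    rw [hf, target, ← hU]; field_simp
  have hf0 : ∀ x, 0 ≤ f x := H1.density.nonneg
  obtain ⟨M, hM0, hM⟩ := H2.exists_target_bound
  obtain ⟨c, hc0, hc⟩ := H2.exists_le_mul
  refine ⟨U ^ 2 * M ^ (1 - κ) * c, by positivity, fun n k hk ω x => ?_⟩
  have hl := hlam_pos n (by omega)
  have h1 := hs.mul_safe_le H3 H2.density.nonneg hh_pos hlam_le hlam_anti hk ω x
  -- In `f² = f * f`, one factor supplies the weight `f^κ` and the other is dominated by `q0`, hence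
  -- by `q_k / λ_n`.
  have h2 : f x ≤ M ^ (1 - κ) * f x ^ κ := by
    calc f x = f x ^ (1 - κ) * f x ^ κ := by
          rw [← Real.rpow_add_of_nonneg (hf0 x) (by linarith) hκ.le, sub_add_cancel, Real.rpow_one]
      _ ≤ M ^ (1 - κ) * f x ^ κ := by
          have := Real.rpow_nonneg (hf0 x) κ
          have := hf0 x
          gcongr
          exact hM x
  have hG := Real.rpow_nonneg (hf0 x) κ
  have hfx := hf0 x
  calc fU x ^ 2 = U ^ 2 * f x * f x := by rw [hff]; ring
    _ ≤ U ^ 2 * (M ^ (1 - κ) * f x ^ κ) * (c * q0 x) := by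
        gcongr
        exact hc x
    _ = U ^ 2 * M ^ (1 - κ) * c * (1 / lam n) * f x ^ κ * (lam n * q0 x) := by field_simp
    _ ≤ U ^ 2 * M ^ (1 - κ) * c * (1 / lam n) * f x ^ κ * q k ω x := by gcongr

/-- Pointwise control of the squared weights when the kernel estimate is accurate. -/
theorem sq_le_of_abs_sub_le {U M c κ δ D l y g s z : ℝ} (hM : 0 < M) (hc : 0 < c) (hκ : 0 < κ)
    (hκ1 : κ < 1) (hl : 0 < l) (hl2 : l ≤ 1 / 2) (hy : 0 ≤ y) (hyM : y ≤ M) (hg : 0 ≤ g)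
    (hD : (2 * δ) ^ (2 - 2 * κ) ≤ D * l) (hD0 : 0 ≤ D)
    (hdom : y ^ κ ≤ c * s) (hs : 0 ≤ s) (habs : |g - y| ≤ δ) (hz : z = (1 - l) * g + l * s) :
    (U * y) ^ 2 ≤ (4 * U ^ 2 * M ^ (1 - κ) + U ^ 2 * D * c) * y ^ κ * z := by
  have hG := Real.rpow_nonneg hy κ
  have hz0 : 0 ≤ z := by rw [hz]; have : 0 ≤ 1 - l := by linarith
                         positivity
  have hMp : 0 ≤ M ^ (1 - κ) := by positivity
  have e1 : 0 ≤ 4 * U ^ 2 * M ^ (1 - κ) * y ^ κ * z := by positivity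
  have e2 : 0 ≤ U ^ 2 * D * c * y ^ κ * z := by positivity
  have e3 : (4 * U ^ 2 * M ^ (1 - κ) + U ^ 2 * D * c) * y ^ κ * z
      = 4 * U ^ 2 * M ^ (1 - κ) * y ^ κ * z + U ^ 2 * D * c * y ^ κ * z := by ring
  rw [e3]
  -- Where the target exceeds twice the error, the kernel part of the policy already gives `z ≥ y /
  -- 4`, using `l ≤ 1 / 2`. Otherwise the smallness of `y` pays for the factor `l` of the safe part.
  rcases le_or_gt (2 * δ) y with hyδ | hyδ
  · have h1 : y / 2 ≤ g := by linarith [(abs_le.1 habs).1]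
    have h2 : y / 4 ≤ z := by rw [hz]; nlinarith [mul_nonneg hl.le hs]
    have h3 : y ≤ M ^ (1 - κ) * y ^ κ := by
      calc y = y ^ (1 - κ) * y ^ κ := by
            rw [← Real.rpow_add_of_nonneg hy (by linarith) hκ.le, sub_add_cancel, Real.rpow_one]
        _ ≤ M ^ (1 - κ) * y ^ κ :=
          mul_le_mul_of_nonneg_right (Real.rpow_le_rpow hy hyM (by linarith)) hG
    calc (U * y) ^ 2 = 4 * U ^ 2 * y * (y / 4) := by ring
      _ ≤ 4 * U ^ 2 * (M ^ (1 - κ) * y ^ κ) * z := by gcongr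
      _ = 4 * U ^ 2 * M ^ (1 - κ) * y ^ κ * z := by ring
      _ ≤ _ := by linarith
  · have h1 : l * s ≤ z := by rw [hz]; nlinarith
    have h2 : y ^ 2 = y ^ (2 - 2 * κ) * y ^ κ * y ^ κ := by
      rw [← Real.rpow_add_of_nonneg hy (by linarith) hκ.le,
        ← Real.rpow_add_of_nonneg hy (by linarith) hκ.le, ← Real.rpow_natCast]
      congr 1; push_cast; ring
    have h3 : y ^ (2 - 2 * κ) ≤ D * l :=
      (Real.rpow_le_rpow hy hyδ.le (by linarith)).trans hD
    calc (U * y) ^ 2 = U ^ 2 * (y ^ (2 - 2 * κ) * y ^ κ * y ^ κ) := by rw [mul_pow, ← h2]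
      _ ≤ U ^ 2 * (D * l * y ^ κ * (c * s)) := by gcongr
      _ = U ^ 2 * D * c * y ^ κ * (l * s) := by ring
      _ ≤ U ^ 2 * D * c * y ^ κ * z := by gcongr
      _ ≤ _ := by linarith

/-- Asymptotic consequences of the rate condition. -/
theorem eventually_of_rate_condition {ε : ℝ} (hε : 0 < ε) (hh_pos : ∀ k, 1 ≤ k → 0 < h k)
    (hlam_pos : ∀ k, 1 ≤ k → 0 < lam k) (hlam_le : ∀ k, 1 ≤ k → lam k ≤ 1)
    (ho : (fun n : ℕ => rate d h n + h n ^ 4) =o[atTop] (fun n : ℕ => lam n ^ (1 + ε)))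
    (hl : Tendsto (fun n : ℕ => lam n ^ (1 + ε)) atTop (𝓝 0)) :
    (∀ᶠ n in atTop, h n ≤ 1) ∧ Tendsto (rate d h) atTop (𝓝 0) ∧
    Tendsto (fun n => rate d h n / lam n) atTop (𝓝 0) ∧ (∀ᶠ n in atTop, lam n ≤ 1 / 2) ∧
    ∀ᶠ n in atTop, rate d h n * √(1 / lam n) + h n ^ 2 ≤ 2 * √(lam n ^ (1 + ε)) := by
  have hbound : ∀ c : ℝ, 0 < c → ∀ᶠ n in atTop, rate d h n + h n ^ 4 ≤ c * lam n ^ (1 + ε) := by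
    intro c hc
    filter_upwards [ho.bound hc, eventually_ge_atTop 1] with n h1 hn
    rw [Real.norm_eq_abs, Real.norm_eq_abs,
      abs_of_nonneg (Real.rpow_nonneg (hlam_pos n hn).le _)] at h1
    exact (le_abs_self _).trans h1
  have hr0 : ∀ n, 0 ≤ rate d h n := fun n => Real.sqrt_nonneg _
  have hpow : ∀ n, 1 ≤ n → lam n ^ (1 + ε) ≤ lam n := fun n hn =>
    Real.rpow_le_self_of_le_one (hlam_pos n hn).le (hlam_le n hn) (by linarith)
  have hratio : Tendsto (fun n => rate d h n / lam n) atTop (𝓝 0) := by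
    rw [← isLittleO_iff_tendsto']
    · refine IsLittleO.of_bound fun c hc => ?_
      filter_upwards [hbound c hc, eventually_ge_atTop 1] with n h1 hn
      rw [Real.norm_of_nonneg (hr0 n), Real.norm_of_nonneg (hlam_pos n hn).le]
      have h2 := mul_le_mul_of_nonneg_left (hpow n hn) hc.le
      have h3 : 0 ≤ h n ^ 4 := by positivity
      linarith
    · filter_upwards [eventually_ge_atTop 1] with n hn h0
      exact absurd h0 (hlam_pos n hn).ne'
  refine ⟨?_, ?_, hratio, ?_, ?_⟩
  · filter_upwards [hbound 1 one_pos, eventually_ge_atTop 1] with n h1 hn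
    have h2 := hpow n hn
    have h3 := hlam_le n hn
    have h4 := hr0 n
    exact (pow_le_one_iff_of_nonneg (hh_pos n hn).le (by norm_num : (4 : ℕ) ≠ 0)).1 (by linarith)
  · refine tendsto_of_tendsto_of_tendsto_of_le_of_le' tendsto_const_nhds hratio
      (Eventually.of_forall hr0) ?_
    filter_upwards [eventually_ge_atTop 1] with n hn
    exact le_div_self (hr0 n) (hlam_pos n hn) (hlam_le n hn)
  · have hpos : (0 : ℝ) < (1 / 2) ^ (1 + ε) := by positivity
    filter_upwards [hl.eventually (eventually_lt_nhds hpos)] with n hn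
    by_contra hcon
    exact absurd hn (not_lt.2 (Real.rpow_le_rpow (by norm_num) (not_le.1 hcon).le (by linarith)))
  · filter_upwards [hbound 1 one_pos, eventually_ge_atTop 1] with n h1 hn
    have hl0 := hlam_pos n hn
    have h2 := hpow n hn
    have h4 := hr0 n
    have h5 : 0 ≤ h n ^ 4 := by positivity
    have h6 : 0 < lam n ^ (1 + ε) := Real.rpow_pos_of_pos hl0 _
    -- After squaring: `a_n² ≤ λ_n^(1+ε) * λ_n^(1+ε) ≤ λ_n^(1+ε) * λ_n`.
    have e1 : rate d h n * √(1 / lam n) ≤ √(lam n ^ (1 + ε)) := by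
      refine Real.le_sqrt_of_sq_le ?_
      rw [mul_pow, Real.sq_sqrt (by positivity), mul_one_div, div_le_iff₀ hl0]
      calc rate d h n ^ 2 ≤ (lam n ^ (1 + ε)) ^ 2 := by gcongr; linarith
        _ = lam n ^ (1 + ε) * lam n ^ (1 + ε) := by ring
        _ ≤ lam n ^ (1 + ε) * lam n := by gcongr
    have e2 : h n ^ 2 ≤ √(lam n ^ (1 + ε)) := by
      refine Real.le_sqrt_of_sq_le ?_
      have : (h n ^ 2) ^ 2 = h n ^ 4 := by ring
      linarith
    linarith

/-- Accuracy of the kernel estimate at the first-stage rate controls all the squared weights. -/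
theorem IsStandardSAIS.exists_sq_le (hs : IsStandardSAIS P fU q0 K h lam X q w)
    (hfU_pos : 0 < ∫ x, fU x) (H1 : SmoothTarget (target fU)) (H2 : SafeDensity (target fU) q0)
    (H3 : AdmissibleKernel K) (hh_pos : ∀ k, 1 ≤ k → 0 < h k) (hlam_pos : ∀ k, 1 ≤ k → 0 < lam k)
    (hlam_le : ∀ k, 1 ≤ k → lam k ≤ 1)
    (hlam_anti : ∀ j k, 1 ≤ j → j ≤ k → lam k ≤ lam j) {ε C : ℝ} (hε : 0 < ε)
    (hl2 : ∀ᶠ n in atTop, lam n ≤ 1 / 2) {ω : Ω}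
    (hacc : ∀ᶠ n in atTop, ∀ x, |kernelEstimate K h X w n ω x - target fU x|
      ≤ C * √(lam n ^ (1 + ε))) :
    ∃ B : ℝ, ∀ k x, fU x ^ 2 ≤ B * target fU x ^ (ε / (1 + ε)) * q k ω x := by
  have hκ : 0 < ε / (1 + ε) := by positivity
  have hκ1 : ε / (1 + ε) < 1 := by rw [div_lt_one (by positivity)]; linarith
  obtain ⟨B, hB0, hB⟩ := hs.exists_sq_le_div hfU_pos H1 H2 H3 hh_pos hlam_pos hlam_le hlam_anti
    hκ hκ1.le
  have hf0 : ∀ x, 0 ≤ target fU x := H1.density.nonneg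
  obtain ⟨M, hM0, hM⟩ := H2.exists_target_bound
  obtain ⟨c, hc0, hc⟩ := H2.dominates _ hκ hκ1.le
  obtain ⟨N, hN⟩ := eventually_atTop.1 (hacc.and (hl2.and (eventually_ge_atTop 1)))
  set κ := ε / (1 + ε) with hκdef
  set U := ∫ x, fU x with hU
  have hff : ∀ x, fU x = U * target fU x := fun x => by
    rw [target, ← hU]; field_simp
  have hN1 : 1 ≤ N := (hN N le_rfl).2.2
  set D := (2 * |C|) ^ (2 - 2 * κ) with hD
  have hD0 : 0 ≤ D := by positivity
  set B' := 4 * U ^ 2 * M ^ (1 - κ) + U ^ 2 * D * c with hB'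
  have hB'0 : 0 ≤ B' := by positivity
  refine ⟨B * (1 / lam N) + B', fun k x => ?_⟩
  have hGq : 0 ≤ target fU x ^ κ * q k ω x :=
    mul_nonneg (Real.rpow_nonneg (hf0 x) κ) ((hs.policy.density k ω).nonneg x)
  have hlN := hlam_pos N hN1
  -- For the finitely many early policies the crude bound at index `N` suffices: `1 / lam N` is a
  -- constant.
  rcases lt_or_ge k N with hk | hk
  · have h1 := hB N k hk ω x
    have h2 := mul_nonneg hB'0 hGq
    linarith
  · obtain ⟨h1, h2, h3⟩ := hN k hk
    have hl0 := hlam_pos k h3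
    -- This identity dictates the choice of `κ`: `(1 + ε) * (1 - κ) = 1`.
    have hσ : √(lam k ^ (1 + ε)) ^ (2 - 2 * κ) = lam k := by
      rw [Real.sqrt_eq_rpow, ← Real.rpow_mul hl0.le, ← Real.rpow_mul hl0.le]
      have : (1 + ε) * (1 / 2) * (2 - 2 * κ) = 1 := by rw [hκdef]; field_simp; ring
      rw [this, Real.rpow_one]
    have h4 := sq_le_of_abs_sub_le (U := U) (δ := |C| * √(lam k ^ (1 + ε))) (D := D) hM0 hc0 hκ hκ1
      hl0 h2 (hf0 x) (hM x) (hs.kernelEstimate_nonneg H3 hh_pos h3 ω x)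
      (by rw [← mul_assoc, Real.mul_rpow (by positivity) (by positivity), hσ]) hD0 (hc x)
      (H2.density.nonneg x)
      ((h1 x).trans (mul_le_mul_of_nonneg_right (le_abs_self C) (Real.sqrt_nonneg _)))
      (hs.update k h3 ω x)
    rw [← hff] at h4
    have h5 : 0 ≤ B * (1 / lam N) * (target fU x ^ κ * q k ω x) := by positivity
    linarith

/-- An eventual uniform bound holds for all `n ≥ 1`, since the kernel estimates are bounded. -/
theorem IsStandardSAIS.exists_forall_abs_sub_le (hs : IsStandardSAIS P fU q0 K h lam X q w)
    (H1 : SmoothTarget (target fU)) (H2 : SafeDensity (target fU) q0)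
    (H3 : AdmissibleKernel K) (hh_pos : ∀ k, 1 ≤ k → 0 < h k) {ω : Ω} {C : ℝ}
    (hC : ∀ᶠ n in atTop, ∀ x, |kernelEstimate K h X w n ω x - target fU x|
      ≤ C * (rate d h n + h n ^ 2)) :
    ∃ C : ℝ, ∀ n : ℕ, 1 ≤ n → ∀ x, |kernelEstimate K h X w n ω x - target fU x|
      ≤ C * (rate d h n + h n ^ 2) := by
  obtain ⟨N, hN⟩ := eventually_atTop.1 hC
  obtain ⟨M, hM0, hM⟩ := H2.exists_target_bound
  obtain ⟨CK, hCK0, hCK⟩ := H3.exists_bound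
  -- The trivial bound on the error divided by `h_n^2`. The absolute value keeps `b 0` nonnegative,
  -- as `h 0` is unconstrained.
  set b : ℕ → ℝ := fun n => (CK / |h n| ^ d + M) / h n ^ 2 with hb
  have hb0 : ∀ n, 0 ≤ b n := fun n => by positivity
  refine ⟨|C| + ∑ n ∈ Finset.range N, b n, fun n hn x => ?_⟩
  have hr0 : 0 ≤ rate d h n := Real.sqrt_nonneg _
  have hh0 := hh_pos n hn
  have hS0 : 0 ≤ ∑ n ∈ Finset.range N, b n := Finset.sum_nonneg fun n _ => hb0 n
  rcases lt_or_ge n N with hnN | hnN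
  · have h1 : b n ≤ ∑ n ∈ Finset.range N, b n :=
      Finset.single_le_sum (fun n _ => hb0 n) (Finset.mem_range.2 hnN)
    have h2 := (hs.weights ω n hn).weighted_mean_mem (b := CK / h n ^ d)
      (g := fun k => scaledKernel K (h n) (x - X k ω)) (fun k => H3.scaledKernel_nonneg hh0 _)
      (fun k => div_le_div_of_nonneg_right (hCK _) (pow_pos hh0 d).le)
    have h3 : |kernelEstimate K h X w n ω x - target fU x| ≤ CK / h n ^ d + M := by
      unfold kernelEstimate
      rw [abs_le]
      constructor <;> linarith [h2.1, h2.2, hM x, H1.density.nonneg x]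
    have h4 : CK / h n ^ d + M = b n * h n ^ 2 := by
      simp only [hb]
      rw [abs_of_pos hh0]
      field_simp
    calc _ ≤ b n * h n ^ 2 := h4 ▸ h3
      _ ≤ (|C| + ∑ n ∈ Finset.range N, b n) * (rate d h n + h n ^ 2) := by
          refine mul_le_mul ?_ ?_ (by positivity) (by positivity)
          · linarith [abs_nonneg C]
          · linarith
  · refine (hN n hnN x).trans (mul_le_mul_of_nonneg_right ?_ (by positivity))
    linarith [le_abs_self C]

end Stages

end SAIS

theorem theorem1 {Ω : Type*} [MeasurableSpace Ω] (P : Measure Ω) [IsProbabilityMeasure P]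
    (d : ℕ) (hd : 1 ≤ d)
    -- unnormalized target, safe density, kernel
    (fU q0 K : SAIS.Space d → ℝ)
    (hfU_meas : Measurable fU) (hfU_nonneg : ∀ x, 0 ≤ fU x)
    (hfU_int : Integrable fU) (hfU_pos : 0 < ∫ x, fU x)
    (H1 : SAIS.SmoothTarget (SAIS.target fU))
    (H2 : SAIS.SafeDensity (SAIS.target fU) q0)
    (H3 : SAIS.AdmissibleKernel K)
    -- bandwidths and mixture weights
    (h lam : ℕ → ℝ)
    (hh_pos : ∀ k, 1 ≤ k → 0 < h k) (hh_bdd : ∃ B : ℝ, ∀ k, 1 ≤ k → h k ≤ B)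
    (hlam_pos : ∀ k, 1 ≤ k → 0 < lam k) (hlam_le : ∀ k, 1 ≤ k → lam k ≤ 1)
    (hlam_anti : ∀ j k, 1 ≤ j → j ≤ k → lam k ≤ lam j)
    -- the algorithm
    (X : ℕ → Ω → SAIS.Space d) (q : ℕ → Ω → SAIS.Space d → ℝ) (w : ℕ → Ω → ℕ → ℝ)
    (hsais : SAIS.IsStandardSAIS P fU q0 K h lam X q w)
    -- the rate condition
    (hrate : ∃ ε : ℝ, 0 < ε ∧
      (fun n : ℕ => SAIS.rate d h n + h n ^ 4) =o[atTop] (fun n : ℕ => lam n ^ (1 + ε)) ∧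
      Tendsto (fun n : ℕ => lam n ^ (1 + ε)) atTop (𝓝 0)) :
    ∀ᵐ ω ∂P, ∃ C : ℝ, ∀ n : ℕ, 1 ≤ n →
      ∀ x, |SAIS.kernelEstimate K h X w n ω x - SAIS.target fU x|
        ≤ C * (SAIS.rate d h n + h n ^ 2) := by
  obtain ⟨ε, hε, ho, hl⟩ := hrate
  obtain ⟨hh1, hr, hrl, hl2, hfirst⟩ :=
    SAIS.eventually_of_rate_condition hε hh_pos hlam_pos hlam_le ho hl
  have hκ : 0 < ε / (1 + ε) := by positivity
  have hκ1 : ε / (1 + ε) ≤ 1 := by rw [div_le_one (by positivity)]; linarith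
  have hinv : ∀ n, 1 ≤ n → 1 ≤ 1 / lam n := fun n hn => by
    rw [one_div]; exact (one_le_inv₀ (hlam_pos n hn)).2 (hlam_le n hn)
  have hstep1 := hsais.eventually_abs_kernelEstimate_sub_le hd hfU_meas hfU_nonneg hfU_int hfU_pos
    H1 H2 H3 hh_pos hlam_pos hlam_le hlam_anti hh1 hr hrl hinv (fun n _ => le_rfl) hκ hκ1
  -- The same result at scale `v = 1`; its hypothesis is checked below for each outcome, with a
  -- constant supplied by the first stage.
  have hstep2 := hsais.eventually_abs_kernelEstimate_sub_le hd hfU_meas hfU_nonneg hfU_int hfU_pos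
    H1 H2 H3 hh_pos hlam_pos hlam_le hlam_anti hh1 hr hrl (v := fun _ => 1)
    (fun _ _ => le_rfl) hinv hκ hκ1
  obtain ⟨B₁, -, hB₁⟩ := hsais.exists_sq_le_div hfU_pos H1 H2 H3 hh_pos hlam_pos hlam_le hlam_anti
    hκ hκ1
  filter_upwards [hstep1, hstep2] with ω e1 e2
  obtain ⟨C₁, hC₁⟩ := e1 ⟨B₁, fun n _ k hk x => hB₁ n k hk ω x⟩
  have hacc : ∀ᶠ n in atTop, ∀ x, |SAIS.kernelEstimate K h X w n ω x - SAIS.target fU x|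
      ≤ |C₁| * 2 * √(lam n ^ (1 + ε)) := by
    filter_upwards [hC₁, hfirst] with n h1 h2 x
    have h3 : 0 ≤ SAIS.rate d h n * √(1 / lam n) + h n ^ 2 :=
      add_nonneg (mul_nonneg (Real.sqrt_nonneg _) (Real.sqrt_nonneg _)) (sq_nonneg _)
    calc _ ≤ _ := h1 x
      _ ≤ |C₁| * (SAIS.rate d h n * √(1 / lam n) + h n ^ 2) :=
          mul_le_mul_of_nonneg_right (le_abs_self C₁) h3
      _ ≤ |C₁| * (2 * √(lam n ^ (1 + ε))) := by gcongr
      _ = _ := by ring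
  obtain ⟨B₂, hB₂⟩ := hsais.exists_sq_le hfU_pos H1 H2 H3 hh_pos hlam_pos hlam_le hlam_anti hε hl2
    hacc
  obtain ⟨C₂, hC₂⟩ := e2 ⟨B₂, fun n _ k _ x => by simpa using hB₂ k x⟩
  simp only [Real.sqrt_one, mul_one] at hC₂
  exact hsais.exists_forall_abs_sub_le H1 H2 H3 hh_pos hC₂
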